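/- Let $E$ be the elliptic curve over $\mathbb{Q}$ given in $\mathbb{P}^2$ by $x^3+y^3+30z^3=0$, with distinguished point (neutral element) $P_0=(1:-1:0)$, and let $P=(1523698559:-2736572309:826803945)\in E(\mathbb{Q})$. For a positive integer $m$, an element $\rho\in E(\mathbb{Q})$ is called divisible by $m$ if $\rho=m\rho'$ for some $\rho'\in E(\mathbb{Q})$, and locally divisible by $m$ if for every place $v$ of $\mathbb{Q}$ (that is, $\mathbb{Q}_v=\mathbb{R}$ or $\mathbb{Q}_v=\mathbb{Q}_p$ for a prime number $p$) there is $\rho'_v\in E(\mathbb{Q}_v)$ such that $m\rho'_v$ is the image of $\rho$ in $E(\mathbb{Q}_v)$. The local-global principle for divisibility by $m$ in $E(\mathbb{Q})$ is the assertion that every element of $E(\mathbb{Q})$ that is locally divisible by $m$ is divisible by $m$. Then for every integer $n\ge 2$ the point $3^{n-1}P$ is locally divisible by $3^n$, but is not divisible by $3^n$. In particular, the local-global principle for divisibility by $3^n$ in $E(\mathbb{Q})$ fails for every $n\ge 2$. -/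

import Mathlib

open scoped LinearAlgebra.Projectivization

/-- The set `E(K)` of `K`-rational points of the plane cubic `E : x³ + y³ + 30z³ = 0`, as a subset of
the projective plane over `K`.  The equation is homogeneous, so it may be tested on any
representative (see `CubicPoint.eqn_mk_iff`). -/
def CubicPoint (K : Type*) [Field K] : Type _ :=
  {P : ℙ K (Fin 3 → K) // P.rep 0 ^ 3 + P.rep 1 ^ 3 + 30 * P.rep 2 ^ 3 = 0}

namespace CubicPoint

theorem eqn_mk_iff {K : Type*} [Field K] (v : Fin 3 → K) (hv : v ≠ 0) :
    (Projectivization.mk K v hv).rep 0 ^ 3 + (Projectivization.mk K v hv).rep 1 ^ 3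
        + 30 * (Projectivization.mk K v hv).rep 2 ^ 3 = 0
      ↔ v 0 ^ 3 + v 1 ^ 3 + 30 * v 2 ^ 3 = 0 := by
  obtain ⟨a, ha⟩ := Projectivization.exists_smul_eq_mk_rep K v hv
  have h : ∀ i, (Projectivization.mk K v hv).rep i = (a : K) * v i := by
    intro i
    rw [← ha]
    rfl
  have h3 : (a : K) ^ 3 ≠ 0 := pow_ne_zero 3 a.ne_zero
  rw [h, h, h]
  constructor
  · intro H
    have H' : (a : K) ^ 3 * (v 0 ^ 3 + v 1 ^ 3 + 30 * v 2 ^ 3) = 0 := by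
      linear_combination H
    exact (mul_eq_zero.mp H').resolve_left h3
  · intro H
    linear_combination (a : K) ^ 3 * H

/-- The point `(x : y : z)` of `E`. -/
def mk {K : Type*} [Field K] (v : Fin 3 → K) (hv : v ≠ 0)
    (h : v 0 ^ 3 + v 1 ^ 3 + 30 * v 2 ^ 3 = 0) : CubicPoint K :=
  ⟨Projectivization.mk K v hv, (eqn_mk_iff v hv).mpr h⟩

theorem ind {K : Type*} [Field K] {p : CubicPoint K → Prop}
    (h : ∀ (v : Fin 3 → K) (hv : v ≠ 0) (he : v 0 ^ 3 + v 1 ^ 3 + 30 * v 2 ^ 3 = 0), p (mk v hv he))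
    (P : CubicPoint K) : p P := by
  obtain ⟨P, hP⟩ := P
  induction P using Projectivization.ind with
  | h v hv => exact h v hv ((eqn_mk_iff v hv).mp hP)

/-- The map `E(F) → E(K)` induced by a field homomorphism `F → K`: apply it to the homogeneous
coordinates. -/
def map {F K : Type*} [Field F] [Field K] (f : F →+* K) (P : CubicPoint F) : CubicPoint K :=
  let φ : (Fin 3 → F) →ₛₗ[f] (Fin 3 → K) :=
    { toFun := fun v i => f (v i)
      map_add' := fun v w => funext fun i => map_add f (v i) (w i)
      map_smul' := fun a v => funext fun i => map_mul f a (v i) }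
  have hφ : Function.Injective φ := fun _ _ h => funext fun i => f.injective (congrFun h i)
  ⟨Projectivization.map φ hφ P.1, by
    induction P using ind with
    | h v hv he =>
      refine (eqn_mk_iff (φ v) _).mpr ?_
      have h30 : f 30 = 30 := map_ofNat f 30
      simpa [φ, h30] using congrArg f he⟩

/-- The Weierstrass cubic `Y² = X³ - 388800` (where `388800 = 432 · 30²`). -/
def weierstrass (K : Type*) [Field K] : WeierstrassCurve.Affine K :=
  { a₁ := 0, a₂ := 0, a₃ := 0, a₄ := 0, a₆ := -388800 }

theorem weierstrass_nonsingular_iff {K : Type*} [Field K] [CharZero K] (X Y : K) :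
    (weierstrass K).Nonsingular X Y ↔ Y ^ 2 = X ^ 3 - 388800 := by
  rw [← WeierstrassCurve.Affine.equation_iff_nonsingular_of_Δ_ne_zero,
    WeierstrassCurve.Affine.equation_iff]
  · simp [weierstrass, sub_eq_add_neg]
  · simp only [WeierstrassCurve.Δ, WeierstrassCurve.b₂, WeierstrassCurve.b₄, WeierstrassCurve.b₆,
      WeierstrassCurve.b₈, weierstrass]
    norm_num

theorem weierstrass_eqn {K : Type*} [Field K] {x y z : K} (h : x ^ 3 + y ^ 3 + 30 * z ^ 3 = 0)
    (hs : x + y ≠ 0) :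
    (-1080 * (x - y) / (x + y)) ^ 2 = (-360 * z / (x + y)) ^ 3 - 388800 := by
  field_simp
  linear_combination (1555200 : K) * h

open Classical in
/-- The linear change of projective coordinates
`(x : y : z) ↦ (X : Y : Z) = (-360z : -1080(x - y) : x + y)`, which sends `E` to the projective
closure of `Y² = X³ - 388800` and `(1 : -1 : 0)` to its point at infinity `(0 : 1 : 0)`. -/
noncomputable def toWeierstrass {K : Type*} [Field K] [CharZero K] (P : CubicPoint K) :
    (weierstrass K).Point :=
  if hs : P.1.rep 0 + P.1.rep 1 = 0 then .zero
  else .some (-360 * P.1.rep 2 / (P.1.rep 0 + P.1.rep 1))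
    (-1080 * (P.1.rep 0 - P.1.rep 1) / (P.1.rep 0 + P.1.rep 1))
    ((weierstrass_nonsingular_iff _ _).mpr (weierstrass_eqn P.2 hs))

/-- The distinguished point `P₀ = (1 : -1 : 0)` of `E`. -/
def origin (K : Type*) [Field K] : CubicPoint K :=
  mk ![1, -1, 0] (fun h => one_ne_zero (congrFun h 0)) (by simp; ring)

theorem ofWeierstrass_eqn {K : Type*} [Field K] [CharZero K] {X Y : K}
    (h : (weierstrass K).Nonsingular X Y) :
    (![Y - 1080, -Y - 1080, 6 * X] : Fin 3 → K) 0 ^ 3 + (![Y - 1080, -Y - 1080, 6 * X] : Fin 3 → K) 1 ^ 3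
      + 30 * (![Y - 1080, -Y - 1080, 6 * X] : Fin 3 → K) 2 ^ 3 = 0 := by
  have h' := (weierstrass_nonsingular_iff X Y).mp h
  simp only [Matrix.cons_val_zero, Matrix.cons_val_one, Matrix.cons_val]
  linear_combination (-6480 : K) * h'

/-- The inverse change of coordinates, `(X : Y : Z) ↦ (Y - 1080Z : -Y - 1080Z : 6X)`. -/
def ofWeierstrass {K : Type*} [Field K] [CharZero K] : (weierstrass K).Point → CubicPoint K
  | .zero => origin K
  | .some X Y h => mk ![Y - 1080, -Y - 1080, 6 * X]
      (fun H => by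
        have h0 : Y - 1080 = 0 := congrFun H 0
        have h1 : -Y - 1080 = 0 := congrFun H 1
        have h2 : (2160 : K) = 0 := by linear_combination -h0 - h1
        norm_num at h2)
      (ofWeierstrass_eqn h)

theorem toWeierstrass_mk_of_eq {K : Type*} [Field K] [CharZero K] {v : Fin 3 → K} (hv : v ≠ 0)
    (he : v 0 ^ 3 + v 1 ^ 3 + 30 * v 2 ^ 3 = 0) (hs : v 0 + v 1 = 0) :
    toWeierstrass (mk v hv he) = .zero := by
  obtain ⟨a, ha⟩ := Projectivization.exists_smul_eq_mk_rep K v hv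
  have h : ∀ i, (mk v hv he).1.rep i = (a : K) * v i := fun i => (congrFun ha i).symm
  have hs' : (mk v hv he).1.rep 0 + (mk v hv he).1.rep 1 = 0 := by
    rw [h, h, ← mul_add, hs, mul_zero]
  exact dif_pos hs'

theorem toWeierstrass_mk_of_ne {K : Type*} [Field K] [CharZero K] {v : Fin 3 → K} (hv : v ≠ 0)
    (he : v 0 ^ 3 + v 1 ^ 3 + 30 * v 2 ^ 3 = 0) (hs : v 0 + v 1 ≠ 0) :
    toWeierstrass (mk v hv he) = .some (-360 * v 2 / (v 0 + v 1))
      (-1080 * (v 0 - v 1) / (v 0 + v 1))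
      ((weierstrass_nonsingular_iff _ _).mpr (weierstrass_eqn he hs)) := by
  obtain ⟨a, ha⟩ := Projectivization.exists_smul_eq_mk_rep K v hv
  have h : ∀ i, (mk v hv he).1.rep i = (a : K) * v i := fun i => (congrFun ha i).symm
  have h0 : (a : K) ≠ 0 := a.ne_zero
  have hs' : ¬ (mk v hv he).1.rep 0 + (mk v hv he).1.rep 1 = 0 := by
    rw [h, h, ← mul_add]
    exact mul_ne_zero h0 hs
  rw [toWeierstrass, dif_neg hs', WeierstrassCurve.Affine.Point.some.injEq, h, h, h]
  constructor <;> field_simp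

/-- The bijection between `E(K)` and the points of `Y² = X³ - 388800` over `K`. -/
noncomputable def equivWeierstrass (K : Type*) [Field K] [CharZero K] :
    CubicPoint K ≃ (weierstrass K).Point where
  toFun := toWeierstrass
  invFun := ofWeierstrass
  left_inv P := by
    induction P using ind with
    | h v hv he =>
      by_cases hs : v 0 + v 1 = 0
      · rw [toWeierstrass_mk_of_eq hv he hs]
        have h1 : v 1 = -v 0 := by linear_combination hs
        have h2 : v 2 = 0 := by
          rw [h1] at he
          have : (30 : K) * v 2 ^ 3 = 0 := by linear_combination he
          simpa using this
        have h0 : v 0 ≠ 0 := by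
          intro h0
          apply hv
          funext i
          fin_cases i <;> simp [h0, h1, h2]
        refine Subtype.ext ((Projectivization.mk_eq_mk_iff' K _ _ _ _).mpr ⟨(v 0)⁻¹, funext fun i => ?_⟩)
        fin_cases i <;> simp [h0, h1, h2]
      · rw [toWeierstrass_mk_of_ne hv he hs]
        refine Subtype.ext ((Projectivization.mk_eq_mk_iff' K _ _ _ _).mpr ⟨-2160 / (v 0 + v 1), funext fun i => ?_⟩)
        fin_cases i <;> simp <;> field_simp <;> ring
  right_inv Q := by
    match Q with
    | .zero =>
      exact toWeierstrass_mk_of_eq _ (by simp; ring) (by simp)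
    | .some X Y h =>
      have hs : (![Y - 1080, -Y - 1080, 6 * X] : Fin 3 → K) 0
          + (![Y - 1080, -Y - 1080, 6 * X] : Fin 3 → K) 1 ≠ 0 := by
        have e : (![Y - 1080, -Y - 1080, 6 * X] : Fin 3 → K) 0
          + (![Y - 1080, -Y - 1080, 6 * X] : Fin 3 → K) 1 = -2160 := by
          simp
          ring
        rw [e]
        norm_num
      refine (toWeierstrass_mk_of_ne _ (ofWeierstrass_eqn h) hs).trans ?_
      rw [WeierstrassCurve.Affine.Point.some.injEq]
      have e : Y - 1080 + (-Y - 1080) = -2160 := by ring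
      constructor
      · simp only [Matrix.cons_val_zero, Matrix.cons_val_one, Matrix.cons_val, e]
        field_simp
        ring
      · simp only [Matrix.cons_val_zero, Matrix.cons_val_one, e]
        field_simp
        ring

open Classical in
/-- The chord-and-tangent group law on `E(K)` with neutral element `(1 : -1 : 0)`.  Since
`equivWeierstrass` is a linear change of projective coordinates, it maps lines to lines and
transports the usual chord-and-tangent law of the Weierstrass cubic to that of `E`. -/
noncomputable instance {K : Type*} [Field K] [CharZero K] : AddCommGroup (CubicPoint K) :=
  (equivWeierstrass K).addCommGroup

theorem zero_eq_origin (K : Type*) [Field K] [CharZero K] : (0 : CubicPoint K) = origin K := rfl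

/-- The point `P = (1523698559 : -2736572309 : 826803945)` of `E(ℚ)`. -/
def pointP : CubicPoint ℚ :=
  mk ![1523698559, -2736572309, 826803945]
    (fun h => by
      have h0 : (1523698559 : ℚ) = 0 := congrFun h 0
      norm_num at h0)
    (by
      simp only [Matrix.cons_val_zero, Matrix.cons_val_one, Matrix.cons_val]
      norm_num)

end CubicPoint

/-- `ρ` is divisible by `m` in the abelian group `A`. -/
def IsDivisibleBy {A : Type*} [AddCommGroup A] (m : ℕ) (ρ : A) : Prop :=
  ∃ ρ' : A, m • ρ' = ρ

/-- `ρ ∈ E(ℚ)` is locally divisible by `m`: its image in `E(ℚ_v)` is divisible by `m` for every place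
`v` of `ℚ`, i.e. in `E(ℝ)` and in `E(ℚ_p)` for every prime number `p`. -/
def IsLocallyDivisibleBy (m : ℕ) (ρ : CubicPoint ℚ) : Prop :=
  IsDivisibleBy m (ρ.map (algebraMap ℚ ℝ)) ∧
    ∀ (p : ℕ) [Fact p.Prime], IsDivisibleBy m (ρ.map (algebraMap ℚ ℚ_[p]))

/-- The local-global principle for divisibility by `m` in `E(ℚ)`. -/
def LocalGlobalDivisibility (m : ℕ) : Prop :=
  ∀ ρ : CubicPoint ℚ, IsLocallyDivisibleBy m ρ → IsDivisibleBy m ρ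

/-! Work on Y² = X³ - 388800. Over a field containing s = √-3 the cube root of unity ζ = (s - 1)/2
acts by X ↦ ζX, and λ = 1 - ζ satisfies λ² = -3ζ, so dividing by 3 means dividing twice by λ. The
image of λ is detected by the class of Y - 360s modulo cubes (`oneSubZeta_pt_cube`,
`eq_oneSubZeta_of_cube`), apart from the point with Y = 360s. Here P = λR for an explicit R whose
class is that of 1/3.

Local side: it suffices that P = 3S + U with 3U = 0 at every place, because 3^(n-1) kills U for n ≥
2. If p ≡ 1 mod 3, this follows once ±R + T lies in the image of λ for some T with 3λT = 0. Such T
have classes like 30, ζ² or 10, and since units modulo p have at most three cube classes, one choice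
always works (`isTripleUpToTorsion_padic_of_mod_three`). At the remaining places √-3 is missing, but
3 or 10 is a cube there, and P is the triple of an explicit point.

Global side: E(ℚ) has no 3-torsion, so 3^(n-1)P = 3^n Q forces P = 3Q. This fails in E(ℚ_19): there
30 is a cube, which puts ker λ inside the image of λ, so R itself would be in that image, although 3
is not a cube (`not_three_nsmul_of_padic`). -/

namespace CubicPoint

open WeierstrassCurve.Affine

/-! ### Chords on the Weierstrass cubic, and homomorphisms that preserve them -/

section Weierstrass

variable {K : Type*} [Field K] [CharZero K]

/-- The affine point `(X, Y)` of `Y² = X³ - 388800`. -/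
def pt (X Y : K) (h : Y ^ 2 = X ^ 3 - 388800) : (weierstrass K).Point :=
  .some X Y ((weierstrass_nonsingular_iff X Y).mpr h)

theorem point_cases (A : (weierstrass K).Point) : A = 0 ∨ ∃ X Y h, A = pt X Y h := by
  match A with
  | .zero => exact Or.inl rfl
  | .some X Y h => exact Or.inr ⟨X, Y, (weierstrass_nonsingular_iff X Y).mp h, rfl⟩

theorem pt_ne_zero {X Y : K} (h : Y ^ 2 = X ^ 3 - 388800) : pt X Y h ≠ 0 :=
  Point.some_ne_zero _

theorem pt_inj {X Y X' Y' : K} {h : Y ^ 2 = X ^ 3 - 388800} {h' : Y' ^ 2 = X' ^ 3 - 388800} :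
    pt X Y h = pt X' Y' h' ↔ X = X' ∧ Y = Y' := by
  rw [pt, pt, Point.some.injEq]

theorem pt_congr {X Y X' Y' : K} {h : Y ^ 2 = X ^ 3 - 388800} {h' : Y' ^ 2 = X' ^ 3 - 388800}
    (hX : X = X') (hY : Y = Y') : pt X Y h = pt X' Y' h' :=
  pt_inj.mpr ⟨hX, hY⟩

omit [CharZero K] in
theorem weierstrass_negY (X Y : K) : (weierstrass K).negY X Y = -Y := by
  simp [negY, weierstrass]

theorem neg_pt {X Y : K} (h : Y ^ 2 = X ^ 3 - 388800) :
    -pt X Y h = pt X (-Y) (by rw [neg_sq, h]) := by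
  rw [pt, Point.neg_some, pt, Point.some.injEq, weierstrass_negY]
  exact ⟨rfl, rfl⟩

/-- The line `Y = l X + c` meets the curve `Y² = X³ - 388800` in `(X₁, Y₁)`, `(X₂, Y₂)` and
`(X₃, -Y₃)`, and the first two of these points are not opposite to each other. -/
structure IsChord (X₁ Y₁ X₂ Y₂ X₃ Y₃ l c : K) : Prop where
  ne : X₁ ≠ X₂ ∨ Y₁ + Y₂ ≠ 0
  fst : Y₁ = l * X₁ + c
  snd : Y₂ = l * X₂ + c
  trd : -Y₃ = l * X₃ + c
  -- Vieta's relations for X³ - 388800 - (lX + c)².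
  sum : X₁ + X₂ + X₃ = l ^ 2
  sum_mul : X₁ * X₂ + X₁ * X₃ + X₂ * X₃ = -2 * l * c
  prod : X₁ * X₂ * X₃ = c ^ 2 + 388800

/-- Treats base change (u = 1) and the automorphism ζ (f = id) at once. -/
theorem IsChord.map {F : Type*} [Field F] {X₁ Y₁ X₂ Y₂ X₃ Y₃ l c : F}
    (H : IsChord X₁ Y₁ X₂ Y₂ X₃ Y₃ l c) (f : F →+* K) {u : K} (hu : u ^ 3 = 1) :
    IsChord (u * f X₁) (f Y₁) (u * f X₂) (f Y₂) (u * f X₃) (f Y₃) (u ^ 2 * f l) (f c) := by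
  have hu0 : u ≠ 0 := fun h => by simp [h] at hu
  have h1 := congrArg f H.fst
  have h2 := congrArg f H.snd
  have h3 := congrArg f H.trd
  have h4 := congrArg f H.sum
  have h5 := congrArg f H.sum_mul
  have h6 := congrArg f H.prod
  simp only [map_add, map_mul, map_pow, map_neg, map_ofNat] at h1 h2 h3 h4 h5 h6
  refine ⟨H.ne.imp (fun h h' => h (f.injective (mul_left_cancel₀ hu0 h')))
    fun h h' => h (f.injective (by rw [map_add, h', map_zero])), ?_, ?_, ?_, ?_, ?_, ?_⟩
  · linear_combination h1 - f l * f X₁ * hu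
  · linear_combination h2 - f l * f X₂ * hu
  · linear_combination h3 - f l * f X₃ * hu
  · linear_combination u * h4 - u * (f l) ^ 2 * hu
  · linear_combination u ^ 2 * h5
  · linear_combination h6 + f X₁ * f X₂ * f X₃ * hu

omit [CharZero K] in
/-- The norm of `Y - e` along a chord, where `e² = -388800`. -/
theorem IsChord.norm_eq {X₁ Y₁ X₂ Y₂ X₃ Y₃ l c e : K} (H : IsChord X₁ Y₁ X₂ Y₂ X₃ Y₃ l c)
    (he : e ^ 2 = -388800) : (Y₁ - e) * (Y₂ - e) * (Y₃ + e) = (e - c) ^ 3 := by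
  have h3 : Y₃ = -(l * X₃ + c) := by linear_combination -H.trd
  rw [H.fst, H.snd, h3]
  linear_combination (-l * (c - e) ^ 2) * H.sum - l ^ 2 * (c - e) * H.sum_mul - l ^ 3 * H.prod
    - l ^ 3 * he

open Classical in
theorem IsChord.add_eq {X₁ Y₁ X₂ Y₂ X₃ Y₃ l c : K} (H : IsChord X₁ Y₁ X₂ Y₂ X₃ Y₃ l c)
    (h₁ : Y₁ ^ 2 = X₁ ^ 3 - 388800) (h₂ : Y₂ ^ 2 = X₂ ^ 3 - 388800)
    (h₃ : Y₃ ^ 2 = X₃ ^ 3 - 388800) : pt X₁ Y₁ h₁ + pt X₂ Y₂ h₂ = pt X₃ Y₃ h₃ := by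
  have hne : ¬(X₁ = X₂ ∧ Y₁ = (weierstrass K).negY X₂ Y₂) := by
    rw [weierstrass_negY]
    rintro ⟨hx, hy⟩
    exact H.ne.elim (fun h => h hx) (fun h => h (by rw [hy]; ring))
  have hl : (weierstrass K).slope X₁ X₂ Y₁ Y₂ = l := by
    by_cases hx : X₁ = X₂
    · have hy : Y₁ ≠ (weierstrass K).negY X₂ Y₂ := fun h => hne ⟨hx, h⟩
      rw [slope_of_Y_ne hx hy]
      have hY : Y₁ = Y₂ := by rw [H.fst, H.snd, hx]
      have h0 : Y₁ + Y₂ ≠ 0 := H.ne.resolve_left fun h => h hx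
      rw [weierstrass_negY]
      have h0' : Y₁ - -Y₁ ≠ 0 := by rw [← hY] at h0; rwa [sub_neg_eq_add]
      rw [div_eq_iff h0']
      simp only [weierstrass]
      subst hx
      linear_combination 2 * X₁ * H.sum - H.sum_mul - 2 * l * H.fst
    · rw [slope_of_X_ne hx, div_eq_iff (sub_ne_zero.mpr hx)]
      linear_combination H.fst - H.snd
  rw [pt, pt, Point.add_some hne, pt, Point.some.injEq, hl, addY, negAddY, addX, weierstrass_negY]
  simp only [weierstrass]
  constructor
  · linear_combination -H.sum
  · linear_combination -H.fst + l * H.sum + H.trd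

open Classical in
theorem pt_add_pt {X₁ Y₁ X₂ Y₂ : K} (h₁ : Y₁ ^ 2 = X₁ ^ 3 - 388800)
    (h₂ : Y₂ ^ 2 = X₂ ^ 3 - 388800) :
    (X₁ = X₂ ∧ Y₁ + Y₂ = 0 ∧ pt X₁ Y₁ h₁ + pt X₂ Y₂ h₂ = 0) ∨
      ∃ X₃ Y₃ l c h₃, IsChord X₁ Y₁ X₂ Y₂ X₃ Y₃ l c ∧
        pt X₁ Y₁ h₁ + pt X₂ Y₂ h₂ = pt X₃ Y₃ h₃ := by
  by_cases hneg : X₁ = X₂ ∧ Y₁ + Y₂ = 0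
  · refine Or.inl ⟨hneg.1, hneg.2, Point.add_of_Y_eq hneg.1 ?_⟩
    rw [weierstrass_negY]
    linear_combination hneg.2
  right
  have hne : X₁ ≠ X₂ ∨ Y₁ + Y₂ ≠ 0 := by
    by_contra! h
    exact hneg h
  -- Secant and tangent slopes satisfy the same second relation, so the two cases merge from here
  -- on.
  obtain ⟨l, hl, hl'⟩ : ∃ l, Y₂ = l * X₂ + (Y₁ - l * X₁) ∧
      X₁ ^ 2 + X₁ * X₂ + X₂ ^ 2 = l * (Y₁ + Y₂) := by
    by_cases hx : X₁ = X₂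
    · have h0 : Y₁ + Y₂ ≠ 0 := hne.resolve_left fun h => h hx
      have hY : Y₁ = Y₂ := by
        rw [hx] at h₁
        have : (Y₁ + Y₂) * (Y₁ - Y₂) = 0 := by linear_combination h₁ - h₂
        exact sub_eq_zero.mp ((mul_eq_zero.mp this).resolve_left h0)
      refine ⟨(X₁ ^ 2 + X₁ * X₂ + X₂ ^ 2) / (Y₁ + Y₂), ?_, ?_⟩
      · rw [hx, hY]; ring
      · field_simp
    · have h0 : X₁ - X₂ ≠ 0 := sub_ne_zero.mpr hx
      refine ⟨(Y₁ - Y₂) / (X₁ - X₂), ?_, ?_⟩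
      · field_simp; ring
      · field_simp
        linear_combination h₂ - h₁
  have H : IsChord X₁ Y₁ X₂ Y₂ (l ^ 2 - X₁ - X₂) (-(l * (l ^ 2 - X₁ - X₂) + (Y₁ - l * X₁))) l
      (Y₁ - l * X₁) := by
    refine ⟨hne, by ring, hl, by ring, by ring, ?_, ?_⟩
    · linear_combination -hl' - l * hl
    · linear_combination -X₁ * hl' - h₁ - X₁ * l * hl
  have h₃ : (-(l * (l ^ 2 - X₁ - X₂) + (Y₁ - l * X₁))) ^ 2 = (l ^ 2 - X₁ - X₂) ^ 3 - 388800 := by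
    linear_combination (l ^ 2 - X₁ - X₂) * H.sum_mul - H.prod
  exact ⟨_, _, _, _, h₃, H, H.add_eq h₁ h₂ h₃⟩

omit [CharZero K] in
theorem pt_map_eqn {F : Type*} [Field F] {X Y : F} (h : Y ^ 2 = X ^ 3 - 388800) (f : F →+* K)
    {u : K} (hu : u ^ 3 = 1) : (f Y) ^ 2 = (u * f X) ^ 3 - 388800 := by
  have := congrArg f h
  simp only [map_sub, map_pow, map_ofNat] at this
  linear_combination this - (f X) ^ 3 * hu

/-- The map `(X, Y) ↦ (u f(X), f(Y))` for a field homomorphism `f` and a cube root of unity `u`. -/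
def twistFun {F : Type*} [Field F] [CharZero F] (f : F →+* K) {u : K} (hu : u ^ 3 = 1) :
    (weierstrass F).Point → (weierstrass K).Point
  | .zero => 0
  | .some X Y h => pt (u * f X) (f Y) (pt_map_eqn ((weierstrass_nonsingular_iff X Y).mp h) f hu)

open Classical in
/-- `twistFun` as a homomorphism of groups. -/
noncomputable def twist {F : Type*} [Field F] [CharZero F] (f : F →+* K) {u : K} (hu : u ^ 3 = 1) :
    (weierstrass F).Point →+ (weierstrass K).Point where
  toFun := twistFun f hu
  map_zero' := rfl
  map_add' A B := by
    have h0 : twistFun f hu 0 = 0 := rfl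
    rcases point_cases A with rfl | ⟨X₁, Y₁, h₁, rfl⟩
    · rw [zero_add, h0, zero_add]
    rcases point_cases B with rfl | ⟨X₂, Y₂, h₂, rfl⟩
    · rw [add_zero, h0, add_zero]
    rcases pt_add_pt h₁ h₂ with ⟨hX, hY, hs⟩ | ⟨X₃, Y₃, l, c, h₃, H, hs⟩
    · rw [hs, h0]
      have hB : pt X₂ Y₂ h₂ = -pt X₁ Y₁ h₁ := by rw [eq_neg_iff_add_eq_zero, add_comm, hs]
      rw [hB, neg_pt]
      refine (Eq.trans ?_ (add_neg_cancel (twistFun f hu (pt X₁ Y₁ h₁)))).symm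
      congr 1
      have hn : -twistFun f hu (pt X₁ Y₁ h₁) = _ := neg_pt (pt_map_eqn h₁ f hu)
      rw [hn]
      exact pt_congr (h := pt_map_eqn (by rw [neg_sq, h₁]) f hu) rfl (map_neg f Y₁)
    · rw [hs]
      exact ((H.map f hu).add_eq (pt_map_eqn h₁ f hu) (pt_map_eqn h₂ f hu)
        (pt_map_eqn h₃ f hu)).symm

theorem twist_pt {F : Type*} [Field F] [CharZero F] (f : F →+* K) {u : K} (hu : u ^ 3 = 1)
    {X Y : F} (h : Y ^ 2 = X ^ 3 - 388800) :
    twist f hu (pt X Y h) = pt (u * f X) (f Y) (pt_map_eqn h f hu) := rfl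

end Weierstrass

end CubicPoint

/-! ### The automorphism ζ and the endomorphism λ = 1 - ζ -/

namespace CubicPoint

noncomputable section Descent

open scoped Classical

variable {K : Type*} [Field K] [CharZero K] {s : K}

theorem zeta_cube (hs : s ^ 2 = -3) : ((s - 1) / 2) ^ 3 = 1 := by
  field_simp
  linear_combination (s - 3) * hs

/-- The automorphism `(X, Y) ↦ (ζX, Y)`, where `ζ = (s - 1) / 2` and `s² = -3`. -/
def rot (hs : s ^ 2 = -3) : (weierstrass K).Point →+ (weierstrass K).Point :=
  twist (RingHom.id K) (zeta_cube hs)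

theorem rot_eqn (hs : s ^ 2 = -3) {X Y : K} (h : Y ^ 2 = X ^ 3 - 388800) :
    Y ^ 2 = ((s - 1) / 2 * X) ^ 3 - 388800 := by
  rw [mul_pow, zeta_cube hs, one_mul, h]

theorem rot_pt (hs : s ^ 2 = -3) {X Y : K} (h : Y ^ 2 = X ^ 3 - 388800) :
    rot hs (pt X Y h) = pt ((s - 1) / 2 * X) Y (rot_eqn hs h) := rfl

theorem rot_rot_rot (hs : s ^ 2 = -3) (A : (weierstrass K).Point) :
    rot hs (rot hs (rot hs A)) = A := by
  rcases point_cases A with rfl | ⟨X, Y, h, rfl⟩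
  · simp only [map_zero]
  · rw [rot_pt, rot_pt, rot_pt]
    exact pt_congr (by linear_combination X * zeta_cube hs) rfl

theorem rot_pt_zero (hs : s ^ 2 = -3) {Y : K} (h : Y ^ 2 = 0 ^ 3 - 388800) :
    rot hs (pt 0 Y h) = pt 0 Y h := by
  rw [rot_pt]
  exact pt_congr (mul_zero _) rfl

/-- The points `(0, Y)` are inflection points, so they are killed by `3`. -/
theorem three_nsmul_pt_zero {Y : K} (h : Y ^ 2 = 0 ^ 3 - 388800) : 3 • pt 0 Y h = 0 := by
  have hY : Y ≠ 0 := by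
    rintro rfl
    norm_num at h
  have h2 : pt 0 Y h + pt 0 Y h = pt 0 (-Y) (by rw [neg_sq, h]) := by
    refine IsChord.add_eq (l := 0) (c := Y) ⟨Or.inr fun h0 => hY ?_, by ring, by ring, by ring,
      by ring, by ring, ?_⟩ _ _ _
    · linear_combination h0 / 2
    · linear_combination -h
  rw [succ_nsmul, two_nsmul, h2, ← neg_pt h, neg_add_cancel]

/-- The three points A, ζA, ζ²A have the same Y, hence lie on a horizontal line; if X = 0 they
coincide in an inflection point. -/
theorem add_rot_add_rot (hs : s ^ 2 = -3) (A : (weierstrass K).Point) :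
    A + rot hs A + rot hs (rot hs A) = 0 := by
  rcases point_cases A with rfl | ⟨X, Y, h, rfl⟩
  · simp only [map_zero, add_zero]
  by_cases hX : X = 0
  · subst hX
    rw [rot_pt_zero, rot_pt_zero, ← three_nsmul_pt_zero h, succ_nsmul, two_nsmul]
  have h2 : pt X Y h + pt ((s - 1) / 2 * X) Y (rot_eqn hs h)
      = pt ((s - 1) / 2 * ((s - 1) / 2 * X)) (-Y) (by rw [neg_sq]; exact rot_eqn hs (rot_eqn hs h)) := by
    refine IsChord.add_eq (l := 0) (c := Y) ⟨Or.inl ?_, ?_, ?_, ?_, ?_, ?_, ?_⟩ _ _ _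
    · intro h0
      have h1 : X * (3 - s) = 0 := by linear_combination 2 * h0
      have h2 : s = 3 := by
        linear_combination -(mul_eq_zero.mp h1).resolve_left hX
      rw [h2] at hs
      norm_num at hs
    · ring
    · ring
    · ring
    · linear_combination X / 4 * hs
    · linear_combination X ^ 2 * ((s - 1) / 8) * hs
    · linear_combination X ^ 3 * zeta_cube hs - h
  rw [rot_pt, rot_pt, h2, ← neg_pt (rot_eqn hs (rot_eqn hs h)), neg_add_cancel]

/-- The endomorphism `1 - ζ`, whose kernel consists of `0` and the two points with `X = 0`. -/
def oneSubZeta (hs : s ^ 2 = -3) :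
    (weierstrass K).Point →+ (weierstrass K).Point :=
  AddMonoidHom.id _ - rot hs

theorem oneSubZeta_apply (hs : s ^ 2 = -3) (A : (weierstrass K).Point) :
    oneSubZeta hs A = A - rot hs A := rfl

theorem oneSubZeta_oneSubZeta (hs : s ^ 2 = -3) (A : (weierstrass K).Point) :
    oneSubZeta hs (oneSubZeta hs A) = 3 • (-rot hs A) := by
  rw [oneSubZeta_apply, oneSubZeta_apply, map_sub]
  have h := add_rot_add_rot hs A
  have h2 : rot hs (rot hs A) = -(A + rot hs A) := by
    rw [eq_neg_iff_add_eq_zero, ← h]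
    abel
  rw [h2]
  abel

theorem oneSubZeta_pt_zero (hs : s ^ 2 = -3) {Y : K} (h : Y ^ 2 = 0 ^ 3 - 388800) :
    oneSubZeta hs (pt 0 Y h) = 0 := by
  rw [oneSubZeta_apply, rot_pt_zero, sub_self]

theorem oneSubZeta_eqn (hs : s ^ 2 = -3) {X Y X' Y' : K} (h : Y ^ 2 = X ^ 3 - 388800) (hX : X ≠ 0)
    (hX' : X' = (1 + s) / 6 * (X ^ 3 - 1555200) / X ^ 2)
    (hY' : Y' = s / 9 * Y * (X ^ 3 + 3110400) / X ^ 3) : Y' ^ 2 = X' ^ 3 - 388800 := by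
  have h3 : (1 + s) ^ 3 = -8 := by linear_combination (s + 3) * hs
  rw [hX', hY', div_pow, div_pow, mul_pow, mul_pow, mul_pow, div_pow, div_pow, h3, hs, h]
  field_simp
  ring

theorem oneSubZeta_pt (hs : s ^ 2 = -3) {X Y X' Y' : K} (h : Y ^ 2 = X ^ 3 - 388800) (hX : X ≠ 0)
    (hX' : X' = (1 + s) / 6 * (X ^ 3 - 1555200) / X ^ 2)
    (hY' : Y' = s / 9 * Y * (X ^ 3 + 3110400) / X ^ 3) :
    oneSubZeta hs (pt X Y h) = pt X' Y' (oneSubZeta_eqn hs h hX hX' hY') := by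
  rw [oneSubZeta_apply, rot_pt, sub_eq_add_neg, neg_pt]
  refine IsChord.add_eq (l := Y * (3 + s) / (3 * X)) (c := - Y * s / 3)
    ⟨Or.inl ?_, ?_, ?_, ?_, ?_, ?_, ?_⟩ _ _ _
  · intro h0
    have h1 : X * (3 - s) = 0 := by linear_combination 2 * h0
    have h2 : s = 3 := by
      linear_combination -(mul_eq_zero.mp h1).resolve_left hX
    rw [h2] at hs
    norm_num at hs
  · field_simp
    ring
  · field_simp
    linear_combination (-Y) * hs
  · rw [hX', hY']
    field_simp
    linear_combination (-9 * Y) * (X ^ 3 - 1555200) * hs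
  · rw [hX']
    field_simp
    linear_combination (-12 * (s + 3) ^ 2) * h + (-12 * X ^ 3 + 4665600) * hs
  · rw [hX']
    field_simp
    linear_combination (-(24 * s ^ 2 + 72 * s)) * h + (-15 * X ^ 3 - 4665600) * hs
  · rw [hX']
    field_simp
    linear_combination (-12 * s ^ 2) * h + (-3 * X ^ 3 - 9331200) * hs

end Descent

end CubicPoint

/-! ### The image of λ and cube classes of Y - 360s -/

namespace CubicPoint

noncomputable section CubeClass

open scoped Classical

variable {K : Type*} [Field K] [CharZero K] {s : K}

theorem oneSubZeta_pt_cube (hs : s ^ 2 = -3) {X Y X' Y' : K} (h : Y ^ 2 = X ^ 3 - 388800)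
    (h' : Y' ^ 2 = X' ^ 3 - 388800) (hX : X ≠ 0) (H : oneSubZeta hs (pt X Y h) = pt X' Y' h') :
    ∃ g, Y' - 360 * s = g ^ 3 := by
  have hs0 : s ≠ 0 := by
    rintro rfl
    norm_num at hs
  rw [oneSubZeta_pt hs h hX rfl rfl, pt_inj] at H
  refine ⟨(Y - 1080) / (s * X), ?_⟩
  rw [← H.2, div_pow, mul_pow]
  have hs3 : s ^ 3 = -3 * s := by linear_combination s * hs
  rw [hs3]
  field_simp
  linear_combination (9 * Y - 29160) * h
    + (9331200 * Y + 3 * Y * X ^ 3 - 9720 * X ^ 3) * hs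

/-- Since (Y - 360s)(Y + 360s) = X³, both factors are cubes as soon as the first is a nonzero cube.
Their cube roots g and k determine the preimage rationally. -/
theorem eq_oneSubZeta_of_cube (hs : s ^ 2 = -3) {X Y g : K} (h : Y ^ 2 = X ^ 3 - 388800)
    (hY : Y ≠ 360 * s) (hg : Y - 360 * s = g ^ 3) : ∃ A, oneSubZeta hs A = pt X Y h := by
  have hs0 : s ≠ 0 := by
    rintro rfl
    norm_num at hs
  have hg0 : g ≠ 0 := by
    rintro rfl
    exact hY (by linear_combination hg)
  -- The factor ζ selects the cube root of Y + 360s for which the preimage maps to X rather than to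
  -- a rotation of it.
  obtain ⟨k, hk⟩ : ∃ k, k * g = (s - 1) / 2 * X := ⟨(s - 1) / 2 * X / g, by field_simp⟩
  have hk3 : k ^ 3 = Y + 360 * s := by
    have : (k ^ 3 - (Y + 360 * s)) * g ^ 3 = 0 := by
      have e : (k * g) ^ 3 = X ^ 3 := by rw [hk, mul_pow, zeta_cube hs, one_mul]
      linear_combination e + (Y + 360 * s) * hg - h + 129600 * hs
    exact sub_eq_zero.mp ((mul_eq_zero.mp this).resolve_right (pow_ne_zero 3 hg0))
  have hgk : g - k ≠ 0 := by
    intro h0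
    have : 720 * s = 0 := by
      rw [sub_eq_zero.mp h0] at hg
      linear_combination -hk3 - hg
    exact hs0 (by linear_combination this / 720)
  have hd : (g - k) * (g ^ 2 + g * k + k ^ 2) = -720 * s := by linear_combination -hk3 - hg
  -- If λ(x, y) = (X, Y), then g = (y - 1080)/(sx) and k = (y + 1080)/(sx); solve these for x and y.
  set x := 720 * s / (g - k) with hx
  have hx0 : x ≠ 0 := div_ne_zero (mul_ne_zero (by norm_num) hs0) hgk
  have hxgk : x * (g - k) = 720 * s := by rw [hx]; field_simp
  have hxx : g ^ 2 + g * k + k ^ 2 = -x := by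
    apply mul_left_cancel₀ hgk
    linear_combination hd + hxgk
  have he : (s * x * (g + k) / 2) ^ 2 = x ^ 3 - 388800 := by
    linear_combination (x ^ 2 * (g + k) ^ 2 / 4 + 129600) * hs - x ^ 2 * hxx
      + (x * (g - k) + 720 * s) / 4 * hxgk
  have hq : (x * (g - k)) ^ 2 = -1555200 := by
    linear_combination (x * (g - k) + 720 * s) * hxgk + 518400 * hs
  have hXgk : X = -(1 + s) / 2 * (k * g) := by linear_combination (1 + s) / 2 * hk + X / 4 * hs
  refine ⟨pt x (s * x * (g + k) / 2) he, ?_⟩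
  rw [oneSubZeta_pt hs he hx0 rfl rfl]
  refine pt_congr ?_ ?_
  · rw [div_eq_iff (pow_ne_zero 2 hx0)]
    linear_combination -(1 + s) / 6 * hq - x ^ 2 * hXgk + (1 + s) / 6 * x ^ 2 * hxx
  · rw [div_eq_iff (pow_ne_zero 3 hx0)]
    linear_combination x * (g + k) * (x ^ 3 + 3110400) / 18 * hs - x * (g + k) / 3 * hq
      - x ^ 3 * (g + k) / 6 * hxx - x ^ 3 / 2 * (hg - hk3)

/-- By `IsChord.norm_eq` the cube class is multiplicative, so a sum with trivial class is in the
image of λ. The criterion does not cover sums equal to 0 or with X = 0; λ kills these, whence the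
extra λ on both sides. -/
theorem exists_oneSubZeta_add (hs : s ^ 2 = -3) {X₁ Y₁ X₂ Y₂ g : K}
    (h₁ : Y₁ ^ 2 = X₁ ^ 3 - 388800) (h₂ : Y₂ ^ 2 = X₂ ^ 3 - 388800) (hY₁ : Y₁ ≠ 360 * s)
    (hY₂ : Y₂ ≠ 360 * s) (hg : (Y₁ - 360 * s) * (Y₂ - 360 * s) = g ^ 3) :
    ∃ A, oneSubZeta hs (pt X₁ Y₁ h₁ + pt X₂ Y₂ h₂) = oneSubZeta hs (oneSubZeta hs A) := by
  rcases pt_add_pt h₁ h₂ with ⟨-, -, h⟩ | ⟨X₃, Y₃, l, c, h₃, H, h⟩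
  · exact ⟨0, by rw [h, map_zero, map_zero]⟩
  rw [h]
  by_cases hX : X₃ = 0
  · subst hX
    exact ⟨0, by rw [oneSubZeta_pt_zero, map_zero, map_zero]⟩
  have he : (360 * s) ^ 2 = -388800 := by linear_combination 129600 * hs
  have hn := H.norm_eq he
  have hprod : (Y₃ - 360 * s) * (Y₃ + 360 * s) = X₃ ^ 3 := by linear_combination h₃ - he
  have hg0 : g ≠ 0 := by
    rintro rfl
    rw [zero_pow three_ne_zero, mul_eq_zero, sub_eq_zero, sub_eq_zero] at hg
    exact hg.elim hY₁ hY₂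
  have hm : Y₃ - 360 * s ≠ 0 := by
    intro h0
    rw [h0, zero_mul] at hprod
    exact hX (pow_eq_zero_iff three_ne_zero |>.mp hprod.symm)
  have hp : Y₃ + 360 * s ≠ 0 := by
    intro h0
    rw [h0, mul_zero] at hprod
    exact hX (pow_eq_zero_iff three_ne_zero |>.mp hprod.symm)
  rw [hg] at hn
  have hc : 360 * s - c ≠ 0 := by
    intro h0
    rw [h0, zero_pow three_ne_zero] at hn
    exact (mul_ne_zero (pow_ne_zero 3 hg0) hp) hn
  obtain ⟨A, hA⟩ := eq_oneSubZeta_of_cube hs (g := X₃ * g / (360 * s - c)) h₃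
    (sub_ne_zero.mp hm) (by
      rw [div_pow, mul_pow, ← hprod, ← hn]
      field_simp)
  exact ⟨A, by rw [hA]⟩

/-- A point `(X, Y)` with `X³ = 4 · 388800` is killed by `3`. -/
theorem three_nsmul_of_X_cube (hs : s ^ 2 = -3) {X Y : K} (h : Y ^ 2 = X ^ 3 - 388800)
    (hX : X ^ 3 = 1555200) : 3 • pt X Y h = 0 := by
  have hX0 : X ≠ 0 := by
    rintro rfl
    norm_num at hX
  have h1 : oneSubZeta hs (oneSubZeta hs (pt X Y h)) = 0 := by
    have e : oneSubZeta hs (pt X Y h) = pt 0 (s / 3 * Y) _ :=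
      oneSubZeta_pt hs h hX0 (by rw [hX]; simp) (by rw [hX]; ring)
    rw [e, oneSubZeta_pt_zero]
  rw [oneSubZeta_oneSubZeta, smul_neg, neg_eq_zero, ← map_nsmul] at h1
  rw [← rot_rot_rot hs (3 • pt X Y h), h1, map_zero, map_zero]

end CubeClass

end CubicPoint

/-- `Q` is the sum of a multiple of `3` and an element killed by `3`. -/
def IsTripleUpToTorsion {A : Type*} [AddCommGroup A] (Q : A) : Prop :=
  ∃ S U : A, 3 • S + U = Q ∧ 3 • U = 0

/-! ### Correcting R by auxiliary torsion points -/

namespace CubicPoint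

noncomputable section SpecialPoints

open scoped Classical

variable {K : Type*} [Field K] [CharZero K] {s : K}

/-- The point of the Weierstrass cubic that corresponds to `pointP`. -/
def weierstrassP (K : Type*) [Field K] [CharZero K] : (weierstrass K).Point :=
  pt (6681244 / 27225) (17041083472 / 4492125) (by norm_num)

theorem eqn_R (hs : s ^ 2 = -3) :
    (50832 / 125 * s) ^ 2 = (-(1188 / 25) * ((s - 1) / 2)) ^ 3 - 388800 := by
  rw [mul_pow, mul_pow, hs, zeta_cube hs]
  norm_num

/-- A preimage of `weierstrassP` under `1 - ζ`. -/
def pointR (hs : s ^ 2 = -3) : (weierstrass K).Point :=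
  pt (-(1188 / 25) * ((s - 1) / 2)) (50832 / 125 * s) (eqn_R hs)

theorem sqrt_ne_zero (hs : s ^ 2 = -3) : s ≠ 0 := by
  rintro rfl
  norm_num at hs

theorem sub_one_ne_zero_of_sq (hs : s ^ 2 = -3) : s - 1 ≠ 0 := by
  intro h
  rw [sub_eq_zero.mp h] at hs
  norm_num at hs

theorem sub_three_ne_zero (hs : s ^ 2 = -3) : s - 3 ≠ 0 := by
  intro h
  rw [sub_eq_zero.mp h] at hs
  norm_num at hs

theorem oneSubZeta_pointR (hs : s ^ 2 = -3) : oneSubZeta hs (pointR hs) = weierstrassP K := by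
  have h1 := sub_one_ne_zero_of_sq hs
  have h3 : ((s - 1) / 2) ^ 2 = -(1 + s) / 2 := by linear_combination hs / 4
  have h4 : 1 + s ≠ 0 := by
    intro h
    rw [← neg_eq_iff_add_eq_zero.mpr h] at hs
    norm_num at hs
  refine oneSubZeta_pt hs _ ?_ ?_ ?_
  · exact mul_ne_zero (by norm_num) (div_ne_zero h1 two_ne_zero)
  · rw [mul_pow, mul_pow, zeta_cube hs, h3]
    field_simp
    norm_num
  · rw [mul_pow, zeta_cube hs]
    have : s / 9 * (50832 / 125 * s) = -(50832 / 375) := by linear_combination 50832 / 1125 * hs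
    rw [this]
    norm_num

theorem isTripleUpToTorsion_of_neg {A : Type*} [AddCommGroup A] {Q : A}
    (h : IsTripleUpToTorsion (-Q)) : IsTripleUpToTorsion Q := by
  obtain ⟨S, U, h, hU⟩ := h
  exact ⟨-S, -U, by rw [smul_neg, ← neg_add, h, neg_neg], by rw [smul_neg, hU, neg_zero]⟩

/-- λB = λ(B + T) - λT, where λ² is 3 up to an automorphism. Only λT has to be killed by 3, not T
itself. -/
theorem isTripleUpToTorsion_of_add {hs : s ^ 2 = -3} {B T A : (weierstrass K).Point}
    (h : oneSubZeta hs (B + T) = oneSubZeta hs (oneSubZeta hs A))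
    (hT : 3 • oneSubZeta hs T = 0) : IsTripleUpToTorsion (oneSubZeta hs B) := by
  refine ⟨-rot hs A, -oneSubZeta hs T, ?_, by rw [smul_neg, hT, neg_zero]⟩
  rw [← oneSubZeta_oneSubZeta, ← h, map_add]
  abel

/-- The two constants are the values of Y - 360s at R and at -R. As s = -s³/3, 5832 = 18³ and 95832
= 9 · 22³, their classes are 1/3 and 3. -/
theorem isTripleUpToTorsion_of_mul_cube (hs : s ^ 2 = -3) {X Y : K} (h : Y ^ 2 = X ^ 3 - 388800)
    (hT : 3 • oneSubZeta hs (pt X Y h) = 0) (hY : Y ≠ 360 * s)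
    (hg : (∃ g, 5832 / 125 * s * (Y - 360 * s) = g ^ 3) ∨
      ∃ g, -(95832 / 125) * s * (Y - 360 * s) = g ^ 3) :
    IsTripleUpToTorsion (weierstrassP K) := by
  have hs0 := sqrt_ne_zero hs
  rw [← oneSubZeta_pointR hs]
  rcases hg with ⟨g, hg⟩ | ⟨g, hg⟩
  · obtain ⟨A, hA⟩ := exists_oneSubZeta_add hs (g := g) (eqn_R hs) h (by
      intro h0
      exact hs0 (by linear_combination 125 / 5832 * h0)) hY (by linear_combination hg)
    exact isTripleUpToTorsion_of_add hA hT
  · refine isTripleUpToTorsion_of_neg ?_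
    rw [← map_neg, pointR, neg_pt]
    obtain ⟨A, hA⟩ := exists_oneSubZeta_add hs (g := g) (X₁ := -(1188 / 25) * ((s - 1) / 2))
      (Y₁ := -(50832 / 125 * s)) (by rw [neg_sq, eqn_R hs]) h (by
      intro h0
      exact hs0 (by linear_combination -125 / 95832 * h0)) hY (by linear_combination hg)
    exact isTripleUpToTorsion_of_add hA hT

theorem isTripleUpToTorsion_of_cube_three (hs : s ^ 2 = -3) {c : K} (hc : c ^ 3 = 3) :
    IsTripleUpToTorsion (weierstrassP K) := by
  have hs0 := sqrt_ne_zero hs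
  have hc0 : c ≠ 0 := by
    rintro rfl
    norm_num at hc
  obtain ⟨A, hA⟩ := eq_oneSubZeta_of_cube hs (g := -18 * s / (5 * c)) (eqn_R hs) (by
    intro h0
    exact hs0 (by linear_combination 125 / 5832 * h0)) (by
    rw [div_pow, mul_pow, mul_pow, hc]
    linear_combination 1944 / 125 * s * hs)
  rw [← oneSubZeta_pointR hs]
  refine isTripleUpToTorsion_of_add (T := 0) (A := A) ?_ (by rw [map_zero, smul_zero])
  rw [add_zero, hA, pointR]

omit [CharZero K] in
theorem eqn_T0 (hs : s ^ 2 = -3) : (-360 * s) ^ 2 = 0 ^ 3 - 388800 := by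
  linear_combination 129600 * hs

/-- T = (0, -360s) in ker λ has class -720s, which is that of 30. So R + T has class 10, and -R + T
has class 90. -/
theorem isTripleUpToTorsion_of_cube_ten (hs : s ^ 2 = -3) {c : K} (hc : c ^ 3 = 10) :
    IsTripleUpToTorsion (weierstrassP K) := by
  refine isTripleUpToTorsion_of_mul_cube hs (eqn_T0 hs) ?_ ?_ (Or.inl ⟨108 / 5 * c, ?_⟩)
  · rw [oneSubZeta_pt_zero, smul_zero]
  · intro h
    exact sqrt_ne_zero hs (by linear_combination -h / 720)
  · linear_combination -(5832 / 125 * 720) * hs - (108 / 5) ^ 3 * hc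

theorem isTripleUpToTorsion_of_cube_ninety (hs : s ^ 2 = -3) {c : K} (hc : c ^ 3 = 90) :
    IsTripleUpToTorsion (weierstrassP K) := by
  refine isTripleUpToTorsion_of_mul_cube hs (eqn_T0 hs) ?_ ?_ (Or.inr ⟨-132 / 5 * c, ?_⟩)
  · rw [oneSubZeta_pt_zero, smul_zero]
  · intro h
    exact sqrt_ne_zero hs (by linear_combination -h / 720)
  · linear_combination (95832 / 125 * 720) * hs + (132 / 5) ^ 3 * hc

omit [CharZero K] in
theorem eqn_T2 {r : K} (hr : r ^ 3 = 30) : (1080 : K) ^ 2 = (12 * r ^ 2) ^ 3 - 388800 := by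
  linear_combination -1728 * (r ^ 3 + 30) * hr

/-- The 3-torsion point T = (12r², 1080) has 1080 - 360s = 720sζ², of class 30ζ², hence ζ² because
30 is a cube. It is added to R in the first case and to -R in the second. -/
theorem isTripleUpToTorsion_of_T2 (hs : s ^ 2 = -3) {r c : K} (hr : r ^ 3 = 30)
    (hc : c ^ 3 = 3 * ((s - 1) / 2) ∨ c ^ 3 = 3 * ((s - 1) / 2) ^ 2) :
    IsTripleUpToTorsion (weierstrassP K) := by
  refine isTripleUpToTorsion_of_mul_cube hs (eqn_T2 hr) ?_ ?_
    (hc.imp (fun hc => ⟨-36 / 5 * r * c ^ 2, ?_⟩) fun hc => ⟨132 / 5 * r * c, ?_⟩)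
  · rw [← map_nsmul, three_nsmul_of_X_cube hs, map_zero]
    linear_combination 1728 * (r ^ 3 + 30) * hr
  · intro h
    exact sub_three_ne_zero hs (by linear_combination -h / 360)
  · have e : (-36 / 5 * r * c ^ 2) ^ 3 = (-36 / 5) ^ 3 * r ^ 3 * (c ^ 3) ^ 2 := by ring
    rw [e, hr, hc]
    linear_combination (1049760 / 125) * hs
  · rw [mul_pow, mul_pow, hr, hc]
    linear_combination (-17249760 / 125) * hs

/-- With a primitive ninth root of unity t, there is a T beyond E[3] with λT in E[3]. Its class is
that of -240s, namely 10, which cancels the class 3 of -R because 30 = r³. -/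
theorem isTripleUpToTorsion_of_T3 (hs : s ^ 2 = -3) {r t : K} (hr : r ^ 3 = 30)
    (ht : t ^ 3 = (s - 1) / 2) : IsTripleUpToTorsion (weierstrassP K) := by
  have h6 : t ^ 6 + t ^ 3 + 1 = 0 := by
    have : t ^ 6 = (t ^ 3) ^ 2 := by ring
    rw [this, ht]
    linear_combination hs / 4
  have hs' : s = 2 * t ^ 3 + 1 := by linear_combination -2 * ht
  have ht0 : t ≠ 0 := by
    rintro rfl
    norm_num at h6
  have ht1 : t + 1 ≠ 0 := by
    intro h
    rw [eq_neg_of_add_eq_zero_left h] at h6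
    norm_num at h6
  have hr0 : r ≠ 0 := by
    rintro rfl
    norm_num at hr
  have hX3 : (-12 * r ^ 2 / (t * (t + 1))) ^ 3 = -1555200 / (t * (t + 1)) ^ 3 := by
    rw [div_pow]
    congr 1
    linear_combination -1728 * (r ^ 3 + 30) * hr
  have he : (-1080 * (t - 1) / (t + 1)) ^ 2 = (-12 * r ^ 2 / (t * (t + 1))) ^ 3 - 388800 := by
    rw [hX3]
    field_simp
    linear_combination 1555200 * h6
  have hY : -1080 * (t - 1) / (t + 1) - 360 * s = -240 * s * (t * (t ^ 3 + t ^ 5 + t ^ 7)) ^ 3 := by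
    rw [hs']
    field_simp
    linear_combination 120 * (6 - 12 * t - 12 * t ^ 3 + 6 * t ^ 4 + 6 * t ^ 6 + 6 * t ^ 7 + 6 * t ^ 9 - 12 * t
      ^ 10 - 10 * t ^ 12 + 8 * t ^ 13 + 6 * t ^ 14 + 14 * t ^ 15 + 20 * t ^ 16 +
      18 * t ^ 17 + 22 * t ^ 18 + 10 * t ^ 19 + 12 * t ^ 20 + 4 * t ^ 21 + 4 * t
      ^ 22) * h6
  -- With N = (t(t + 1))³, this is the condition X(λT)³ = 1555200.
  have hN : (1 + (t * (t + 1)) ^ 3) ^ 3 = 27 * (t * (t + 1)) ^ 3 := by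
    linear_combination (1 - 25 * t ^ 3 - 72 * t ^ 4 - 72 * t ^ 5 + 3 * t ^ 6 + 90 * t ^ 7 + 117 * t ^ 8
      + 83 * t ^ 9 + 36 * t ^ 10 + 9 * t ^ 11 + 1 * t ^ 12) * h6
  refine isTripleUpToTorsion_of_mul_cube hs he ?_ ?_ (Or.inr ⟨-132 / 5 * r * (t * (t ^ 3 + t ^ 5 + t ^ 7)), ?_⟩)
  · have hX0 : -12 * r ^ 2 / (t * (t + 1)) ≠ 0 :=
      div_ne_zero (mul_ne_zero (by norm_num) (pow_ne_zero 2 hr0)) (mul_ne_zero ht0 ht1)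
    rw [oneSubZeta_pt hs he hX0 rfl rfl]
    apply three_nsmul_of_X_cube hs
    have h8 : (1 + s) ^ 3 = -8 := by linear_combination (s + 3) * hs
    rw [div_pow, mul_pow, div_pow, h8, ← pow_mul, mul_comm 2 3, pow_mul, hX3]
    have hN0 := pow_ne_zero 3 (mul_ne_zero ht0 ht1)
    generalize (t * (t + 1)) ^ 3 = N at hN hN0
    field_simp
    linear_combination 8 * hN
  · intro h
    rw [h, sub_self] at hY
    have h0 := eq_zero_of_pow_eq_zero ((mul_eq_zero.mp hY.symm).resolve_left
      (mul_ne_zero (by norm_num) (sqrt_ne_zero hs)))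
    have h1 : t ^ 4 * (1 + t ^ 2 + t ^ 4) = 0 := by linear_combination h0
    have h2 := (mul_eq_zero.mp h1).resolve_left (pow_ne_zero 4 ht0)
    have h3 : t ^ 3 = -2 := by linear_combination h6 - (t ^ 2 - 1) * h2
    have h4 : t ^ 6 = 4 := by
      have : t ^ 6 = (t ^ 3) ^ 2 := by ring
      rw [this, h3]
      norm_num
    rw [h3, h4] at h6
    norm_num at h6
  · rw [hY]
    linear_combination (95832 * 240 / 125) * (t * (t ^ 3 + t ^ 5 + t ^ 7)) ^ 3 * hs
      + (2299968 / 125) * (t * (t ^ 3 + t ^ 5 + t ^ 7)) ^ 3 * hr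

end SpecialPoints

end CubicPoint

/-! ### Explicit thirds of P over fields containing a cube root of 3 or of 10 -/

namespace CubicPoint

section Tripling

open scoped Classical

variable {K : Type*} [Field K] [CharZero K]

/-- Explicit coordinates avoid √-3, which ℝ and ℚ_p for p ≡ 2 mod 3 do not contain. The certificate
is the tangent giving 2A and the chord giving 2A + A. -/
theorem exists_three_nsmul_of_cube_three {c : K} (hc : c ^ 3 = 3) :
    ∃ A, 3 • A = weierstrassP K := by
  have h₁ : (-152496 / 125 - 78408 / 125 * c - 21384 / 125 * c ^ 2) ^ 2 =
      (1188 / 25 + 324 / 25 * c + 1452 / 25 * c ^ 2) ^ 3 - 388800 := by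
    linear_combination (-9217784448 / 15625 - 7513995456 / 15625 * c - 2049271488 / 15625 *
      c ^ 2 - 3061257408 / 15625 * c ^ 3) * hc
  have h₂ : (9903774846033 / 43986977000 - 34569047715741 / 43986977000 * c + 20815626134457
    / 43986977000 * c ^ 2) ^ 2 =
      (-896105133 / 12460900 + 539586441 / 12460900 * c + 496061643 / 12460900 * c ^ 2) ^ 3
        - 388800 := by
    linear_combination (-261655403514115577606204121 / 967427072799264500000 +
      661533001515136103326355151 / 1934854145598529000000 * c - 398339686657726016646393027
      / 1934854145598529000000 * c ^ 2 - 122069437147289094848014707 /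
      1934854145598529000000 * c ^ 3) * hc
  have h₃ : pt _ _ h₁ + pt _ _ h₁ = pt _ _ h₂ := by
    refine IsChord.add_eq (l := (-9801 / 3530 - 43923 / 3530 * c - 729 / 3530 * c ^ 2)) (c
      := (48009294 / 44125 + 1587762 / 44125 * c + 7115526 / 44125 * c ^ 2))
      ⟨Or.inr fun h => ?_, ?_, ?_, ?_, ?_, ?_, ?_⟩ _ _ _
    -- The multiplier of `h` below is the inverse of 2Y₁ modulo c³ = 3, so the tangent is not
    -- vertical.
    · refine one_ne_zero (α := K) ?_
      linear_combination (-125 / 304992 + 121 / 508320 * c - 11 / 169440 * c ^ 2) * h -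
        (9801 / 441250 * c) * hc
    · linear_combination (32006196 / 44125 + 529254 / 44125 * c) * hc
    · linear_combination (32006196 / 44125 + 529254 / 44125 * c) * hc
    · linear_combination (11090937030489 / 21993488500 + 361628937747 / 43986977000 * c) *
      hc
    · linear_combination (-32019867 / 6230450 - 531441 / 12460900 * c) * hc
    · linear_combination (441045000 / 124609 + 988267500 / 124609 * c) * hc
    · linear_combination (1126023378695208 / 1947015625 + 44843317766676 / 1947015625 * c +
      401088666889548 / 1947015625 * c ^ 2 + 261462186545868 / 1947015625 * c ^ 3) * hc
  have h₄ : pt _ _ h₂ + pt _ _ h₁ = weierstrassP K := by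
    refine IsChord.add_eq (l := (-1670311 / 116490 - 2673 / 3530 * c - 11979 / 3530 * c ^
      2)) (c := (-12121902 / 44125 + 90196794 / 485375 * c + 36746842 / 44125 * c ^ 2))
      ⟨Or.inl fun h => ?_, ?_, ?_, ?_, ?_, ?_, ?_⟩ _ _ _
    · refine one_ne_zero (α := K) ?_
      linear_combination (-25 / 3564 - 11 / 5400 * c + 1 / 1800 * c ^ 2) * h - (107811 /
        1993744 - 25296381 / 2492180000 * c) * hc
    · linear_combination (3894839374239 / 21993488500 + 5942322421497 / 43986977000 * c) *
      hc
    · linear_combination (3881196 / 44125 + 8696754 / 44125 * c) * hc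
    · ring
    · linear_combination (-32019867 / 6230450 - 143496441 / 12460900 * c) * hc
    · linear_combination (39602253834 / 77880625 - 260120043909 / 77880625 * c) * hc
    · linear_combination (54118076400 / 124609 - 392897234664 / 3115225 * c) * hc
  exact ⟨pt _ _ h₁, by rw [succ_nsmul, two_nsmul, h₃, h₄]⟩

theorem exists_three_nsmul_of_cube_ten {c : K} (hc : c ^ 3 = 10) :
    ∃ A, 3 • A = weierstrassP K := by
  have h₁ : (103240 / 3 + 48400 / 3 * c + 22000 / 3 * c ^ 2) ^ 2 =
      (2200 / 3 + 1000 / 3 * c + 484 / 3 * c ^ 2) ^ 3 - 388800 := by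
    linear_combination (-2133799040 / 27 - 515363200 / 9 * c - 234256000 / 9 * c ^ 2 -
      113379904 / 27 * c ^ 3) * hc
  have h₂ : (225809748631160 / 51580466823 + 93391871988800 / 51580466823 * c +
    51275108192000 / 51580466823 * c ^ 2) ^ 2 =
      (3631381600 / 19984683 + 1993744000 / 19984683 * c + 661415524 / 19984683 * c ^ 2) ^ 3
        - 388800 := by
    linear_combination (-10818660349788797772989978240 / 7981633673035811139987 -
      1588622307495574640506201600 / 2660544557678603713329 * c -
      872204175357240606732544000 / 2660544557678603713329 * c ^ 2 -
      289349776941722298898997824 / 7981633673035811139987 * c ^ 3) * hc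
  have h₃ : pt _ _ h₁ + pt _ _ h₁ = pt _ _ h₂ := by
    refine IsChord.add_eq (l := (60500 / 2581 + 29282 / 2581 * c + 12500 / 2581 * c ^ 2)) (c
      := (-133362440 / 7743 - 60500000 / 7743 * c - 29282000 / 7743 * c ^ 2))
      ⟨Or.inr fun h => ?_, ?_, ?_, ?_, ?_, ?_, ?_⟩ _ _ _
    · refine one_ne_zero (α := K) ?_
      linear_combination (3 / 206480 - 121 / 557496 * c + 55 / 557496 * c ^ 2) * h - (302500
        / 209061 * c) * hc
    · linear_combination (-26672488 / 7743 - 6050000 / 7743 * c) * hc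
    · linear_combination (-26672488 / 7743 - 6050000 / 7743 * c) * hc
    · linear_combination (-44289369373768 / 51580466823 - 8267694050000 / 51580466823 * c) *
      hc
    · linear_combination (-732050000 / 6661561 - 156250000 / 6661561 * c) * hc
    · linear_combination (2117016000 / 6661561 + 512317872 / 6661561 * c) * hc
    · linear_combination (3585066466701440 / 179862147 + 759425524000000 / 59954049 * c +
      369098907232000 / 59954049 * c ^ 2 + 154940554990144 / 179862147 * c ^ 3) * hc
  have h₄ : pt _ _ h₂ + pt _ _ h₁ = weierstrassP K := by
    refine IsChord.add_eq (l := (3340622 / 425865 + 27500 / 2581 * c + 13310 / 2581 * c ^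
      2)) (c := (-132837560 / 23229 - 668124400 / 255519 * c - 146987368 / 116145 * c ^ 2))
      ⟨Or.inl fun h => ?_, ?_, ?_, ?_, ?_, ?_, ?_⟩ _ _ _
    · refine one_ne_zero (α := K) ?_
      linear_combination (-1 / 2200 - 11 / 3240 * c + 1 / 648 * c ^ 2) * h - (499125 /
        6661561 - 106782500 / 539586441 * c) * hc
    · linear_combination (-44725659550000 / 51580466823 - 8803440624440 / 51580466823 * c) *
      hc
    · linear_combination (-26620000 / 7743 - 6442040 / 7743 * c) * hc
    · ring
    · linear_combination (-732050000 / 6661561 - 177156100 / 6661561 * c) * hc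
    · linear_combination (-1607334476000 / 59954049 - 462435633616 / 59954049 * c) * hc
    · linear_combination (259766766720 / 6661561 - 1940233257600 / 6661561 * c) * hc
  exact ⟨pt _ _ h₁, by rw [succ_nsmul, two_nsmul, h₃, h₄]⟩

end Tripling

end CubicPoint

/-! ### Cubes and cube roots of unity in ℤ_p and modulo p -/

section PadicRoots

variable {p : ℕ} [Fact p.Prime]

theorem PadicInt.exists_root_of_toZMod (F : Polynomial ℤ_[p]) (a : ℤ_[p])
    (h0 : PadicInt.toZMod (F.eval a) = 0) (h1 : PadicInt.toZMod (F.derivative.eval a) ≠ 0) :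
    ∃ z, F.eval z = 0 := by
  have hker : ∀ x : ℤ_[p], PadicInt.toZMod x = 0 ↔ ‖x‖ < 1 := fun x => by
    rw [← RingHom.mem_ker, PadicInt.ker_toZMod, IsLocalRing.mem_maximalIdeal,
      PadicInt.mem_nonunits]
  have hn0 := (hker _).mp h0
  have hn1 : ‖F.derivative.eval a‖ = 1 :=
    le_antisymm (PadicInt.norm_le_one _) (not_lt.mp fun h => h1 ((hker _).mpr h))
  obtain ⟨z, hz, -⟩ := hensels_lemma (F := F) (a := a) (by
    change ‖F.eval a‖ < ‖F.derivative.eval a‖ ^ 2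
    rw [hn1, one_pow]
    exact hn0)
  exact ⟨z, hz⟩

theorem PadicInt.exists_cube_eq (hp : (3 : ZMod p) ≠ 0) {u : ℤ_[p]} {a : ZMod p}
    (ha : a ≠ 0) (hu : a ^ 3 = PadicInt.toZMod u) : ∃ z : ℤ_[p], z ^ 3 = u := by
  obtain ⟨b, rfl⟩ := ZMod.ringHom_surjective (PadicInt.toZMod (p := p)) a
  obtain ⟨z, hz⟩ := PadicInt.exists_root_of_toZMod (Polynomial.X ^ 3 - Polynomial.C u) b
    (by simp [hu]) (by simpa [map_ofNat] using ⟨by norm_num; exact hp, ha⟩)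
  exact ⟨z, by simpa [sub_eq_zero] using hz⟩

theorem PadicInt.exists_zeta (h2 : (3 : ZMod p) ≠ 0) {a : ZMod p} (ha : a ^ 2 + a + 1 = 0) :
    ∃ z : ℤ_[p], z ^ 2 + z + 1 = 0 := by
  obtain ⟨b, rfl⟩ := ZMod.ringHom_surjective (PadicInt.toZMod (p := p)) a
  obtain ⟨z, hz⟩ := PadicInt.exists_root_of_toZMod
    (Polynomial.X ^ 2 + Polynomial.X + Polynomial.C 1) b (by simpa using ha) (by
      intro h
      apply h2
      have h' : 2 * PadicInt.toZMod b + 1 = 0 := by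
        have e : (1 : ZMod p) + 1 = 2 := by norm_num
        simpa [e] using h
      linear_combination 4 * ha - (2 * PadicInt.toZMod b + 1) * h')
  exact ⟨z, by simpa using hz⟩

/-- The cube classes of `(ZMod p)ˣ` form a cyclic group of order at most `3`. -/
theorem ZMod.exists_cube_or {a b : ZMod p} (ha : a ≠ 0) (hb : b ≠ 0) :
    (∃ x, x ^ 3 = b) ∨ (∃ x, x ^ 3 = a) ∨ (∃ x, x ^ 3 = a * b) ∨ ∃ x, x ^ 3 = a * b ^ 2 := by
  obtain ⟨g, hg⟩ := IsCyclic.exists_generator (α := (ZMod p)ˣ)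
  obtain ⟨i, hi⟩ := Subgroup.mem_zpowers_iff.mp (hg (Units.mk0 a ha))
  obtain ⟨j, hj⟩ := Subgroup.mem_zpowers_iff.mp (hg (Units.mk0 b hb))
  have key : ∀ k : ℤ, 3 ∣ k → ∀ c : (ZMod p)ˣ, g ^ k = c → ∃ x : ZMod p, x ^ 3 = (c : ZMod p) := by
    rintro _ ⟨m, rfl⟩ c rfl
    exact ⟨((g ^ m : (ZMod p)ˣ) : ZMod p), by
      rw [← Units.val_pow_eq_pow_val, ← zpow_natCast, ← zpow_mul, mul_comm]; rfl⟩
  have h1 := key j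
  have h2 := key i
  have h3 := key (i + j)
  have h4 := key (i + j + j)
  have hdvd : (3 : ℤ) ∣ j ∨ (3 : ℤ) ∣ i ∨ (3 : ℤ) ∣ i + j ∨ (3 : ℤ) ∣ i + j + j := by
    have hi : i % 3 = 0 ∨ i % 3 = 1 ∨ i % 3 = 2 := by omega
    have hj : j % 3 = 0 ∨ j % 3 = 1 ∨ j % 3 = 2 := by omega
    rcases hi with hi | hi | hi <;> rcases hj with hj | hj | hj <;> omega
  rcases hdvd with h | h | h | h
  · exact Or.inl (h1 h _ hj)
  · exact Or.inr (Or.inl (h2 h _ hi))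
  · exact Or.inr (Or.inr (Or.inl (h3 h (Units.mk0 a ha * Units.mk0 b hb)
      (by rw [zpow_add, hi, hj]))))
  · refine Or.inr (Or.inr (Or.inr ?_))
    obtain ⟨x, hx⟩ := h4 h (Units.mk0 a ha * Units.mk0 b hb * Units.mk0 b hb)
      (by rw [zpow_add, zpow_add, hi, hj])
    exact ⟨x, by rw [hx, sq, ← mul_assoc]; rfl⟩

theorem ZMod.exists_zeta (hp : p % 3 = 1) : ∃ a : ZMod p, a ^ 2 + a + 1 = 0 := by
  obtain ⟨g, hg⟩ := exists_prime_orderOf_dvd_card (G := (ZMod p)ˣ) 3 (by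
    rw [ZMod.card_units_eq_totient, Nat.totient_prime Fact.out]
    omega)
  refine ⟨g, ?_⟩
  have h3 : ((g : ZMod p)) ^ 3 = 1 := by
    rw [← Units.val_pow_eq_pow_val, ← hg, pow_orderOf_eq_one, Units.val_one]
  have h1 : (g : ZMod p) - 1 ≠ 0 := by
    intro h
    have : g = 1 := Units.ext (by simpa [sub_eq_zero] using h)
    rw [this, orderOf_one] at hg
    omega
  refine (mul_eq_zero.mp (?_ : ((g : ZMod p) - 1) * _ = 0)).resolve_left h1
  linear_combination h3

theorem ZMod.exists_cube_eq_of_mod_three (hp : p % 3 = 2) {a : ZMod p} (ha : a ≠ 0) :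
    ∃ x, x ^ 3 = a := by
  -- The exponent inverts 3 modulo p - 1.
  refine ⟨a ^ ((2 * p - 1) / 3), ?_⟩
  have h : (2 * p - 1) / 3 * 3 = (p - 1) + (p - 1) + 1 := by omega
  rw [← pow_mul, h, pow_succ, pow_add, ZMod.pow_card_sub_one_eq_one ha, one_mul, one_mul]

theorem PadicInt.exists_cube_eq_ten : ∃ z : ℤ_[3], z ^ 3 = 10 := by
  have h54 : ‖(54 : ℤ_[3])‖ ≤ (3 : ℝ) ^ (-3 : ℤ) := by
    have := (PadicInt.norm_int_le_pow_iff_dvd (p := 3) (k := 54) (n := 3)).mpr (by norm_num)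
    exact_mod_cast this
  have h48 : ‖(48 : ℤ_[3])‖ = 1 / 3 := by
    have e : (48 : ℤ_[3]) = ((3 : ℕ) : ℤ_[3]) * ((16 : ℤ) : ℤ_[3]) := by norm_num
    have h16 : ‖((16 : ℤ) : ℤ_[3])‖ = 1 := by
      refine le_antisymm (PadicInt.norm_le_one _) (not_lt.mp fun h => ?_)
      rw [PadicInt.norm_int_lt_one_iff_dvd] at h
      norm_num at h
    rw [e, norm_mul, PadicInt.norm_p, h16]
    norm_num
  -- The derivative is divisible by 3, so the value must be divisible by 27: 4³ - 10 = 54 is,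
  -- whereas 1³ - 10 = -9 is not.
  obtain ⟨z, hz, -⟩ := hensels_lemma (p := 3)
    (F := (Polynomial.X ^ 3 - Polynomial.C 10 : Polynomial ℤ_[3])) (a := 4) (by
    have e1 : (Polynomial.X ^ 3 - Polynomial.C 10 : Polynomial ℤ_[3]).eval 4 = 54 := by
      simp; norm_num
    have e2 : (Polynomial.X ^ 3 - Polynomial.C 10 : Polynomial ℤ_[3]).derivative.eval 4 = 48 := by
      simp; norm_num
    change ‖Polynomial.eval _ _‖ < ‖Polynomial.eval _ _‖ ^ 2
    rw [e1, e2, h48]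
    refine h54.trans_lt ?_
    norm_num)
  exact ⟨z, by simpa [sub_eq_zero] using hz⟩

end PadicRoots

/-! ### Transfer to the plane cubic, and divisibility at every place -/

namespace CubicPoint

noncomputable section Transfer

open scoped Classical

variable {K : Type*} [Field K] [CharZero K]

/-- `equivWeierstrass` as an isomorphism of groups. -/
def addEquivWeierstrass (K : Type*) [Field K] [CharZero K] :
    CubicPoint K ≃+ (weierstrass K).Point where
  __ := equivWeierstrass K
  map_add' _ _ := (equivWeierstrass K).apply_symm_apply _

theorem toWeierstrass_map {F : Type*} [Field F] [CharZero F] (f : F →+* K) (P : CubicPoint F) :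
    toWeierstrass (P.map f) = twist f (one_pow 3) (toWeierstrass P) := by
  induction P using ind with
  | h v hv he =>
    have hv' : (fun i => f (v i)) ≠ 0 := fun h => hv (funext fun i =>
      f.injective ((congrFun h i).trans (map_zero f).symm))
    have he' : (f (v 0)) ^ 3 + (f (v 1)) ^ 3 + 30 * (f (v 2)) ^ 3 = 0 := by
      have := congrArg f he
      simpa only [map_add, map_mul, map_pow, map_ofNat, map_zero] using this
    have hm : (mk v hv he).map f = mk (fun i => f (v i)) hv' he' := rfl
    rw [hm]
    by_cases hs : v 0 + v 1 = 0
    · rw [toWeierstrass_mk_of_eq hv he hs, toWeierstrass_mk_of_eq hv' he'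
        (by rw [← map_add, hs, map_zero])]
      rfl
    · have hs' : f (v 0) + f (v 1) ≠ 0 := by
        rw [← map_add]
        exact fun h => hs (f.injective (h.trans (map_zero f).symm))
      rw [toWeierstrass_mk_of_ne hv he hs, toWeierstrass_mk_of_ne hv' he' hs']
      exact pt_congr (h := weierstrass_eqn he' hs')
        (h' := pt_map_eqn (weierstrass_eqn he hs) f (one_pow 3))
        (by simp only [one_mul, map_div₀, map_mul, map_add, map_neg, map_ofNat])
        (by simp only [map_div₀, map_mul, map_add, map_sub, map_neg, map_ofNat])

theorem addEquivWeierstrass_map {F : Type*} [Field F] [CharZero F] (f : F →+* K)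
    (P : CubicPoint F) : addEquivWeierstrass K (P.map f)
      = twist f (one_pow 3) (addEquivWeierstrass F P) := toWeierstrass_map f P

theorem addEquivWeierstrass_pointP : addEquivWeierstrass ℚ pointP = weierstrassP ℚ := by
  refine (toWeierstrass_mk_of_ne _ _ ?_).trans ?_
  · simp only [Matrix.cons_val_zero, Matrix.cons_val_one]
    norm_num
  · rw [weierstrassP, pt, WeierstrassCurve.Affine.Point.some.injEq]
    constructor <;>
    · simp only [Matrix.cons_val_zero, Matrix.cons_val_one, Matrix.cons_val]
      norm_num

theorem twist_weierstrassP {F : Type*} [Field F] [CharZero F] (f : F →+* K) :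
    twist f (one_pow 3) (weierstrassP F) = weierstrassP K := by
  rw [weierstrassP, twist_pt]
  refine pt_congr ?_ ?_ <;> simp only [one_mul, map_div₀, map_ofNat]

theorem addEquivWeierstrass_map_nsmul {F : Type*} [Field F] [CharZero F] (f : F →+* K) (k : ℕ)
    (P : CubicPoint F) : addEquivWeierstrass K ((k • P).map f)
      = k • addEquivWeierstrass K (P.map f) := by
  rw [addEquivWeierstrass_map, addEquivWeierstrass_map, map_nsmul, map_nsmul]

theorem addEquivWeierstrass_map_pointP (f : ℚ →+* K) :
    addEquivWeierstrass K (pointP.map f) = weierstrassP K := by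
  rw [addEquivWeierstrass_map, addEquivWeierstrass_pointP, twist_weierstrassP]

theorem isDivisibleBy_map (f : ℚ →+* K) (h : IsTripleUpToTorsion (weierstrassP K)) {n : ℕ}
    (hn : 2 ≤ n) : IsDivisibleBy (3 ^ n) (((3 ^ (n - 1)) • pointP).map f) := by
  obtain ⟨S, U, h, hU⟩ := h
  obtain ⟨m, rfl⟩ := Nat.exists_eq_add_of_le hn
  refine ⟨(addEquivWeierstrass K).symm S, (addEquivWeierstrass K).injective ?_⟩
  rw [map_nsmul, AddEquiv.apply_symm_apply, addEquivWeierstrass_map_nsmul,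
    addEquivWeierstrass_map_pointP, ← h, smul_add]
  have e1 : 2 + m - 1 = m + 1 := by omega
  have e2 : 2 + m = m + 1 + 1 := by omega
  -- The exponent n - 1 = m + 1 is positive, which is where n ≥ 2 enters.
  have e3 : 3 ^ (m + 1) • U = 0 := by rw [pow_succ, mul_nsmul', hU, nsmul_zero]
  rw [e1, e2, e3, add_zero, pow_succ 3 (m + 1), mul_nsmul']

theorem isTripleUpToTorsion_of_three_nsmul {A : Type*} [AddCommGroup A] {Q : A}
    (h : ∃ S, 3 • S = Q) : IsTripleUpToTorsion Q := by
  obtain ⟨S, h⟩ := h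
  exact ⟨S, 0, by rw [h, add_zero], smul_zero 3⟩

theorem isTripleUpToTorsion_real : IsTripleUpToTorsion (weierstrassP ℝ) := by
  refine isTripleUpToTorsion_of_three_nsmul
    (exists_three_nsmul_of_cube_three (c := (3 : ℝ) ^ ((3 : ℕ) : ℝ)⁻¹) ?_)
  exact Real.rpow_inv_natCast_pow (by norm_num) (by norm_num)

theorem sq_eq_of_zeta {R : Type*} [CommRing R] {z : R} (hz : z ^ 2 + z + 1 = 0) :
    (2 * z + 1) ^ 2 = -3 := by
  linear_combination 4 * hz

theorem isTripleUpToTorsion_padic_of_mod_three {p : ℕ} [Fact p.Prime] (hp : p % 3 = 1) :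
    IsTripleUpToTorsion (weierstrassP ℚ_[p]) := by
  have hpp : p.Prime := Fact.out
  have hne : ∀ q : ℕ, q.Prime → q % 3 ≠ 1 → (q : ZMod p) ≠ 0 := by
    intro q hq hq1 h
    rw [ZMod.natCast_eq_zero_iff, Nat.prime_dvd_prime_iff_eq hpp hq] at h
    exact hq1 (h ▸ hp)
  have h2 : (2 : ZMod p) ≠ 0 := by exact_mod_cast hne 2 Nat.prime_two (by norm_num)
  have h3 : (3 : ZMod p) ≠ 0 := by exact_mod_cast hne 3 Nat.prime_three (by norm_num)
  have h5 : (5 : ZMod p) ≠ 0 := by exact_mod_cast hne 5 Nat.prime_five (by norm_num)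
  have h10 : (10 : ZMod p) ≠ 0 := by
    have e : (10 : ZMod p) = 2 * 5 := by norm_num
    rw [e]
    exact mul_ne_zero h2 h5
  have h30 : (30 : ZMod p) ≠ 0 := by
    have e : (30 : ZMod p) = 3 * 10 := by norm_num
    rw [e]
    exact mul_ne_zero h3 h10
  have t3 : PadicInt.toZMod (3 : ℤ_[p]) = 3 := map_ofNat _ _
  have t10 : PadicInt.toZMod (10 : ℤ_[p]) = 10 := map_ofNat _ _
  have t30 : PadicInt.toZMod (30 : ℤ_[p]) = 30 := map_ofNat _ _
  have t90 : PadicInt.toZMod (90 : ℤ_[p]) = 3 * 30 := by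
    rw [map_ofNat]
    norm_num
  obtain ⟨a, ha⟩ := ZMod.exists_zeta hp
  obtain ⟨z, hz⟩ := PadicInt.exists_zeta h3 ha
  have hs : (2 * (z : ℚ_[p]) + 1) ^ 2 = -3 := sq_eq_of_zeta
    (by simpa using congrArg (fun x : ℤ_[p] => (x : ℚ_[p])) hz)
  have hzs : (2 * (z : ℚ_[p]) + 1 - 1) / 2 = z := by ring
  have lift : ∀ (u : ℤ_[p]) (x : ZMod p), PadicInt.toZMod u ≠ 0 → x ^ 3 = PadicInt.toZMod u →
      ∃ c : ℤ_[p], (c : ℚ_[p]) ^ 3 = u := by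
    intro u x hu hx
    obtain ⟨c, hc⟩ := PadicInt.exists_cube_eq h3 (a := x) (by
      rintro rfl
      exact hu (by rw [← hx]; simp)) hx
    exact ⟨c, by rw [← hc]; simp⟩
  -- Either 30 is a cube, or one of 3, 3 · 30 and 3 · 30² is; the last has the class of 100, so then
  -- 10 is a cube.
  rcases ZMod.exists_cube_or h3 h30 with ⟨x, hx⟩ | ⟨x, hx⟩ | ⟨x, hx⟩ | ⟨x, hx⟩
  · obtain ⟨r, hr⟩ := lift 30 x (t30 ▸ h30) (t30 ▸ hx)
    have hr' : (r : ℚ_[p]) ^ 3 = 30 := by rw [hr]; rfl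
    have hZ : (PadicInt.toZMod z) ^ 2 + PadicInt.toZMod z + 1 = 0 := by
      simpa using congrArg PadicInt.toZMod hz
    have hZ0 : PadicInt.toZMod z ≠ 0 := by
      intro h
      rw [h] at hZ
      norm_num at hZ
    -- When 30 is a cube, ker λ no longer changes the class, and ζ takes over the role of 30.
    rcases ZMod.exists_cube_or h3 hZ0 with ⟨x, hx⟩ | ⟨x, hx⟩ | ⟨x, hx⟩ | ⟨x, hx⟩
    · obtain ⟨t, ht⟩ := lift z x hZ0 hx
      exact isTripleUpToTorsion_of_T3 hs hr' (by rw [hzs, ht])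
    · obtain ⟨c, hc⟩ := lift 3 x (t3 ▸ h3) (t3 ▸ hx)
      exact isTripleUpToTorsion_of_cube_three hs (by rw [hc]; rfl)
    · obtain ⟨c, hc⟩ := lift (3 * z) x (by simpa [t3] using ⟨h3, hZ0⟩) (by simpa [t3] using hx)
      exact isTripleUpToTorsion_of_T2 hs hr' (Or.inl (by rw [hzs, hc, PadicInt.coe_mul]; rfl))
    · obtain ⟨c, hc⟩ := lift (3 * z ^ 2) x (by simpa [t3] using ⟨h3, hZ0⟩) (by simpa [t3] using hx)
      exact isTripleUpToTorsion_of_T2 hs hr' (Or.inr (by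
        rw [hzs, hc, PadicInt.coe_mul, PadicInt.coe_pow]; rfl))
  · obtain ⟨c, hc⟩ := lift 3 x (t3 ▸ h3) (t3 ▸ hx)
    exact isTripleUpToTorsion_of_cube_three hs (by rw [hc]; rfl)
  · obtain ⟨c, hc⟩ := lift 90 x (t90 ▸ mul_ne_zero h3 h30) (t90 ▸ hx)
    exact isTripleUpToTorsion_of_cube_ninety hs (by rw [hc]; rfl)
  · have hx0 : x ≠ 0 := by
      rintro rfl
      rw [zero_pow three_ne_zero] at hx
      exact mul_ne_zero h3 (pow_ne_zero 2 h30) hx.symm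
    obtain ⟨c, hc⟩ := lift 10 (30 / x) (t10 ▸ h10) (by
      rw [div_pow, hx, t10]
      field_simp
      norm_num)
    exact isTripleUpToTorsion_of_cube_ten hs (by rw [hc]; rfl)

theorem isTripleUpToTorsion_padic (p : ℕ) [Fact p.Prime] :
    IsTripleUpToTorsion (weierstrassP ℚ_[p]) := by
  have hpp : p.Prime := Fact.out
  rcases (by omega : p % 3 = 0 ∨ p % 3 = 1 ∨ p % 3 = 2) with hp | hp | hp
  · obtain rfl : p = 3 :=
      ((Nat.prime_dvd_prime_iff_eq Nat.prime_three hpp).mp (Nat.dvd_of_mod_eq_zero hp)).symm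
    obtain ⟨c, hc⟩ := PadicInt.exists_cube_eq_ten
    refine isTripleUpToTorsion_of_three_nsmul (exists_three_nsmul_of_cube_ten (c := (c : ℚ_[3])) ?_)
    rw [← PadicInt.coe_pow, hc]
    rfl
  · exact isTripleUpToTorsion_padic_of_mod_three hp
  -- This case includes p = 2 and p = 5, which divide 30.
  · have h3 : (3 : ZMod p) ≠ 0 := by
      intro h
      have h' : ((3 : ℕ) : ZMod p) = 0 := by exact_mod_cast h
      rw [ZMod.natCast_eq_zero_iff, Nat.prime_dvd_prime_iff_eq hpp Nat.prime_three] at h'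
      omega
    obtain ⟨x, hx⟩ := ZMod.exists_cube_eq_of_mod_three hp h3
    obtain ⟨c, hc⟩ := PadicInt.exists_cube_eq h3 (u := 3) (a := x) (by
      rintro rfl
      exact h3 (by rw [← hx]; simp)) (by rw [map_ofNat, hx])
    refine isTripleUpToTorsion_of_three_nsmul
      (exists_three_nsmul_of_cube_three (c := (c : ℚ_[p])) ?_)
    rw [← PadicInt.coe_pow, hc]
    rfl

theorem isLocallyDivisibleBy_pointP {n : ℕ} (hn : 2 ≤ n) :
    IsLocallyDivisibleBy (3 ^ n) ((3 ^ (n - 1)) • pointP) :=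
  ⟨isDivisibleBy_map _ isTripleUpToTorsion_real hn,
    fun p _ => isDivisibleBy_map _ (isTripleUpToTorsion_padic p) hn⟩

/-! ### Non-divisibility over ℚ -/

theorem rat_cube_ne (X : ℚ) : X ^ 3 ≠ 1555200 := by
  intro h
  have hv := congrArg (padicValRat 2) h
  rw [padicValRat.pow] at hv
  have e : (1555200 : ℚ) = ((2 ^ 8 * 6075 : ℕ) : ℚ) := by norm_num
  have e2 : padicValNat 2 (2 ^ 8 * 6075) = 8 := by
    rw [padicValNat.mul (by norm_num) (by norm_num), padicValNat.prime_pow,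
      padicValNat.eq_zero_of_not_dvd (by norm_num)]
  rw [e, padicValRat.of_nat, e2] at hv
  push_cast at hv
  omega

/-- A nonzero point killed by 3 is an inflection point: the tangent meets the curve there three
times, and Vieta's relations give X(X³ - 1555200) = 0. -/
theorem eq_zero_of_three_nsmul (h0 : ∀ Y : K, Y ^ 2 ≠ -388800)
    (h1 : ∀ X : K, X ^ 3 ≠ 1555200) {A : (weierstrass K).Point} (hA : 3 • A = 0) : A = 0 := by
  rcases point_cases A with rfl | ⟨X, Y, h, rfl⟩
  · rfl
  rw [succ_nsmul, two_nsmul] at hA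
  rcases pt_add_pt h h with ⟨-, -, e0⟩ | ⟨X₃, Y₃, l, c, h₃, H, e0⟩
  · rwa [e0, zero_add] at hA
  rw [e0, ← eq_neg_iff_add_eq_zero, neg_pt, pt_inj] at hA
  obtain ⟨rfl, -⟩ := hA
  have h4 : X₃ * (X₃ ^ 3 - 1555200) = 0 := by
    have e : (X₃ + X₃ + X₃) * (4 * c ^ 2) = (3 * X₃ ^ 2) ^ 2 := by
      linear_combination 4 * c ^ 2 * H.sum - (3 * X₃ ^ 2 - 2 * l * c) * H.sum_mul
    linear_combination e / 3 + 4 * X₃ * H.prod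
  rcases mul_eq_zero.mp h4 with h5 | h5
  · subst h5
    exact absurd (by rw [h]; ring) (h0 Y)
  · exact absurd (sub_eq_zero.mp h5) (h1 _)

instance factPrimeNineteen : Fact (Nat.Prime 19) := ⟨by norm_num⟩

theorem padic_cube_ne (c : ℚ_[19]) : c ^ 3 ≠ 3 := by
  intro h
  have hn3 : ‖(3 : ℚ_[19])‖ = 1 := by
    have := (Padic.norm_natCast_eq_one_iff (p := 19) (n := 3)).mpr (by norm_num)
    exact_mod_cast this
  have hn : ‖c‖ ≤ 1 := by
    have h' := congrArg norm h
    rw [norm_pow, hn3] at h'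
    exact ((pow_eq_one_iff_of_nonneg (norm_nonneg c) three_ne_zero).mp h').le
  obtain ⟨d, rfl⟩ : ∃ d : ℤ_[19], (d : ℚ_[19]) = c := ⟨⟨c, hn⟩, rfl⟩
  have h' : d ^ 3 = 3 := Subtype.ext (by rw [PadicInt.coe_pow, h]; rfl)
  have h'' := congrArg PadicInt.toZMod h'
  rw [map_pow, map_ofNat] at h''
  generalize PadicInt.toZMod d = x at h''
  revert x
  decide

/-- Modulo 19, 7 is a primitive cube root of unity, 30 = (-2)³, and 3 is not a cube. If P = 3Q, then
R differs from a λ-multiple by an element of ker λ, which is again a λ-multiple, contradicting the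
class of R. -/
theorem not_three_nsmul_of_padic (Q : (weierstrass ℚ_[19]).Point) :
    3 • Q ≠ weierstrassP ℚ_[19] := by
  intro hQ
  have h3 : (3 : ZMod 19) ≠ 0 := by decide
  obtain ⟨z, hz⟩ := PadicInt.exists_zeta h3 (a := (7 : ZMod 19)) (by decide)
  have hs : (2 * (z : ℚ_[19]) + 1) ^ 2 = -3 := sq_eq_of_zeta
    (by simpa using congrArg (fun x : ℤ_[19] => (x : ℚ_[19])) hz)
  obtain ⟨r, hr⟩ := PadicInt.exists_cube_eq h3 (u := 30) (a := (-2 : ZMod 19)) (by decide)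
    (by rw [map_ofNat]; decide)
  have hr' : (r : ℚ_[19]) ^ 3 = 30 := by
    rw [← PadicInt.coe_pow, hr]
    rfl
  generalize 2 * (z : ℚ_[19]) + 1 = s at hs
  generalize (r : ℚ_[19]) = r at hr'
  have hs0 := sqrt_ne_zero hs
  have hr0 : r ≠ 0 := by
    rintro rfl
    norm_num at hr'
  have hX6 : (12 * r ^ 2) ^ 3 = 1555200 := by linear_combination 1728 * (r ^ 3 + 30) * hr'
  -- A point (0, Y) is the image of the 3-torsion point with X = 12r², which exists because 30 = r³.
  have hker : ∀ A, oneSubZeta hs A = 0 → ∃ B, oneSubZeta hs B = A := by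
    intro A hA
    rcases point_cases A with rfl | ⟨X, Y, h, rfl⟩
    · exact ⟨0, map_zero _⟩
    by_cases hX : X = 0
    · subst hX
      have hY : (3 * Y / s) ^ 2 = (12 * r ^ 2) ^ 3 - 388800 := by
        rw [hX6, div_pow, hs, mul_pow, h]
        norm_num
      refine ⟨pt (12 * r ^ 2) (3 * Y / s) hY, ?_⟩
      refine oneSubZeta_pt hs hY (mul_ne_zero (by norm_num) (pow_ne_zero 2 hr0)) ?_ ?_
      · rw [hX6]
        simp
      · rw [hX6]
        field_simp
        ring
    · rw [oneSubZeta_pt hs h hX rfl rfl] at hA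
      exact absurd hA (pt_ne_zero _)
  -- The factor -ζ² compensates the unit in λ² = -3ζ.
  have hQ' : oneSubZeta hs (oneSubZeta hs (-rot hs (rot hs Q))) = weierstrassP ℚ_[19] := by
    rw [oneSubZeta_oneSubZeta, map_neg, rot_rot_rot, neg_neg, hQ]
  obtain ⟨B, hB⟩ := hker (pointR hs - oneSubZeta hs (-rot hs (rot hs Q))) (by
    rw [map_sub, oneSubZeta_pointR, hQ', sub_self])
  have hR : oneSubZeta hs (B + -rot hs (rot hs Q)) = pointR hs := by
    rw [map_add, hB, sub_add_cancel]
  rcases point_cases (B + -rot hs (rot hs Q)) with h0 | ⟨X, Y, h, h0⟩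
  · rw [h0, map_zero] at hR
    exact pt_ne_zero _ hR.symm
  rw [h0] at hR
  by_cases hX : X = 0
  · subst hX
    rw [oneSubZeta_pt_zero] at hR
    exact pt_ne_zero _ hR.symm
  obtain ⟨g, hg⟩ := oneSubZeta_pt_cube hs h (eqn_R hs) hX hR
  have hg0 : g ≠ 0 := by
    rintro rfl
    exact hs0 (by linear_combination 125 / 5832 * hg)
  refine padic_cube_ne (-18 * s / (5 * g)) ?_
  rw [div_pow, mul_pow, mul_pow, ← hg]
  field_simp
  linear_combination -729000 * hs

theorem three_nsmul_ne_pointP (Q : CubicPoint ℚ) : 3 • Q ≠ pointP := by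
  intro h
  refine not_three_nsmul_of_padic
    (addEquivWeierstrass ℚ_[19] (Q.map (algebraMap ℚ ℚ_[19]))) ?_
  rw [← addEquivWeierstrass_map_nsmul, h, addEquivWeierstrass_map_pointP]

theorem eq_zero_of_three_pow_nsmul (h0 : ∀ Y : K, Y ^ 2 ≠ -388800)
    (h1 : ∀ X : K, X ^ 3 ≠ 1555200) {Q : CubicPoint K} (n : ℕ) (h : 3 ^ n • Q = 0) : Q = 0 := by
  induction n with
  | zero => simpa using h
  | succ n ih =>
    apply ih
    rw [pow_succ', mul_nsmul'] at h
    have h' := congrArg (addEquivWeierstrass K) h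
    rw [map_nsmul, map_zero] at h'
    exact (map_eq_zero_iff _ (addEquivWeierstrass K).injective).mp
      (eq_zero_of_three_nsmul h0 h1 h')

theorem not_isDivisibleBy_pointP {n : ℕ} (hn : 2 ≤ n) :
    ¬ IsDivisibleBy (3 ^ n) ((3 ^ (n - 1)) • pointP) := by
  rintro ⟨Q, hQ⟩
  -- 3Q - P is killed by 3^(n-1), hence vanishes because E(ℚ) has no 3-torsion.
  refine three_nsmul_ne_pointP Q (sub_eq_zero.mp (eq_zero_of_three_pow_nsmul
    (fun Y h => by nlinarith [sq_nonneg Y]) rat_cube_ne (n - 1) ?_))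
  rw [smul_sub, ← mul_nsmul', ← pow_succ, Nat.sub_add_cancel (by omega), hQ, sub_self]

end Transfer

end CubicPoint

theorem mainTheorem2 (n : ℕ) (hn : 2 ≤ n) :
    IsLocallyDivisibleBy (3 ^ n) (3 ^ (n - 1) • CubicPoint.pointP) ∧
      ¬ IsDivisibleBy (3 ^ n) (3 ^ (n - 1) • CubicPoint.pointP) ∧
      ¬ LocalGlobalDivisibility (3 ^ n) :=
  ⟨CubicPoint.isLocallyDivisibleBy_pointP hn, CubicPoint.not_isDivisibleBy_pointP hn,
    fun h => CubicPoint.not_isDivisibleBy_pointP hn (h _ (CubicPoint.isLocallyDivisibleBy_pointP hn))⟩
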